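/- Let $\mathbb X$ be a virtual equipment, that is, a virtual double category with all loose-identities $A(1,1)$ and all restrictions $p(f,g)$ of loose-cells along tight-cells. Write $E(f,g)$ for the restriction of $E(1,1)$ along tight-cells $f\colon A\to E$ and $g\colon B\to E$; it is a loose-cell $B\nrightarrow A$. A chain $p_1,\dots,p_n$ consists of loose-cells $p_i\colon A_i\nrightarrow A_{i-1}$. *Weighted colimits.* For a loose-cell $p\colon Y\nrightarrow Z$ and a tight-cell $f\colon Z\to W$, a $p$-cocone for $f$ is a tight-cell $w\colon Y\to W$ with a 2-cell $\lambda\colon p\Rightarrow W(f,w)$. It is the colimit of $f$ weighted by $p$ when, for every chain $q_1,\dots,q_n$ of loose-cells from $W$ to $Y$, pasting with $\lambda$ is a bijection from 2-cells $q_1,\dots,q_n\Rightarrow W(w,1)$ to 2-cells $p,q_1,\dots,q_n\Rightarrow W(f,1)$. Given a tight-cell $j\colon A\to W$, such a colimit is $j$-absolute when the composite $W(j,f)\odot p$ exists (i.e. there is an opcartesian 2-cell $W(j,f),p\Rightarrow W(j,f)\odot p$: any 2-cell whose domain is a chain containing $W(j,f),p$ consecutively, with arbitrary loose-cells before and after,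 factors uniquely through it), and the canonical 2-cell $W(j,f)\odot p\Rightarrow W(j,w)$ induced by $\lambda$ is invertible. For a tight-cell $g\colon W\to X$, a colimit $(c,\lambda)$ of $f$ followed by $g$, weighted by $p$, is strictly created by $g$ when there is a unique $p$-cocone $(w,\lambda')$ for $f$ that postcomposition with $g$ sends to $(c,\lambda)$ (strict equality of tight-cells and 2-cells), and this cocone is the $p$-weighted colimit of $f$. *Relative monads.* Let $j\colon A\to E$ be a tight-cell. A $j$-monad $T$ consists of a tight-cell $t\colon A\to E$, a 2-cell $\dagger\colon E(j,t)\Rightarrow E(t,t)$ and a 2-cell $\eta\colon j\Rightarrow t$ satisfying the two unit laws and the associativity law. A $T$-algebra with domain $D$ is a tight-cell $e\colon D\to E$ with a 2-cell $\rtimes\colon E(j,e)\Rightarrow E(t,e)$ compatible with $\eta$ and $\dagger$. A $(p_1,\dots,p_n)$-graded morphism from $(e,\rtimes)$ to $(e',\rtimes')$ is a 2-cell $p_1,\dots,p_n\Rightarrow E(e,e')$ compatible with $\rtimes$ and $\rtimes'$. A $T$-algebra $(u_T\colon \mathbf{Alg}(T)\to E,\rtimes_T)$ is an algebra object when (1)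 every $T$-algebra $(e,\rtimes)$ is of the form $(x$ followed by $u_T,\ \rtimes_T(1,x))$ for a unique tight-cell $x$ from its domain to $\mathbf{Alg}(T)$, and (2) every graded morphism $p_1,\dots,p_n\Rightarrow E(e,e')$ of $T$-algebras is the postcomposition by $u_T$ of a unique 2-cell $p_1,\dots,p_n\Rightarrow\mathbf{Alg}(T)(x,x')$, where $x,x'$ are the tight-cells corresponding to the two algebras. **Proposition.** Let $j\colon A\to E$ be any tight-cell of $\mathbb X$ and let $T$ be a $j$-monad that admits an algebra object $(u_T,\rtimes_T)$. Then the tight-cell $u_T\colon\mathbf{Alg}(T)\to E$ strictly creates $j$-absolute colimits: for every loose-cell $p\colon Y\nrightarrow Z$ and every tight-cell $f\colon Z\to\mathbf{Alg}(T)$, every $j$-absolute $p$-weighted colimit of the composite of $f$ and $u_T$ is strictly created by $u_T$. -/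

import Mathlib

open CategoryTheory

universe v w z u

set_option linter.checkUnivs false

namespace FormalCat

/-! ## Virtual double categories -/

/-- Objects, tight-cells `A ⟶ B` (the morphisms of a category), and loose-cells:
`Loose Y Z` is the type of loose-cells `Y ⇸ Z`. -/
class LooseData (X : Type u) extends Category.{v} X where
  Loose : X → X → Type w

open LooseData

/-- `LooseChain A₀ Aₙ` is the type of chains `p₁, …, pₙ` of loose-cells `pᵢ : Aᵢ ⇸ Aᵢ₋₁`. -/
inductive LooseChain {X : Type u} [LooseData.{v, w} X] : X → X → Type (max u w)
  | nil (A : X) : LooseChain A A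
  | cons {A B C : X} (p : Loose B A) (c : LooseChain B C) : LooseChain A C

namespace LooseChain

variable {X : Type u} [LooseData.{v, w} X]

/-- The chain consisting of one loose-cell. -/
def single {A B : X} (p : Loose B A) : LooseChain A B := cons p (nil B)

/-- Concatenation of chains. -/
def append : {A B C : X} → LooseChain A B → LooseChain B C → LooseChain A C
  | _, _, _, nil _, d => d
  | _, _, _, cons p c, d => cons p (append c d)

theorem append_nil : {A B : X} → (c : LooseChain A B) → c.append (nil B) = c
  | _, _, nil _ => rfl
  | _, _, cons p c => congrArg (cons p) (append_nil c)

theorem append_assoc : {A B C D : X} → (c : LooseChain A B) → (d : LooseChain B C) →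
    (e : LooseChain C D) → (c.append d).append e = c.append (d.append e)
  | _, _, _, _, nil _, _, _ => rfl
  | _, _, _, _, cons p c, d, e => congrArg (cons p) (append_assoc c d e)

end LooseChain

/-- `Cell f g c q` is the type of 2-cells with domain the chain `c`, codomain the loose-cell `q`,
left boundary the tight-cell `f` and right boundary the tight-cell `g`. -/
class CellData (X : Type u) extends LooseData.{v, w} X where
  Cell : ∀ {A B A' B' : X}, (A ⟶ A') → (B ⟶ B') → LooseChain A B → Loose B' A' → Type z

open CellData

/-- Chains of horizontally adjacent 2-cells: `CellChain f g c d` is the type of sequences of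
2-cells whose codomains form the chain `d`, whose domains concatenate to the chain `c`, and whose
outer boundaries are `f` and `g`. -/
inductive CellChain {X : Type u} [CellData.{v, w, z} X] :
    ∀ {A B A' B' : X}, (A ⟶ A') → (B ⟶ B') → LooseChain A B → LooseChain A' B' →
      Type (max u v w z)
  | nil {A A' : X} (f : A ⟶ A') : CellChain f f (LooseChain.nil A) (LooseChain.nil A')
  | cons {A B C A' B' C' : X} {f : A ⟶ A'} {g : B ⟶ B'} {h : C ⟶ C'}
      {c : LooseChain A B} {c₁ : LooseChain B C} {c₂ : LooseChain A C}
      {q : Loose B' A'} {d : LooseChain B' C'}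
      (φ : Cell f g c q) (Γ : CellChain g h c₁ d) (hc : c.append c₁ = c₂) :
      CellChain f h c₂ (LooseChain.cons q d)

namespace CellChain

variable {X : Type u} [CellData.{v, w, z} X]

/-- The chain consisting of one 2-cell. -/
def single {A B A' B' : X} {f : A ⟶ A'} {g : B ⟶ B'} {c : LooseChain A B} {q : Loose B' A'}
    (φ : Cell f g c q) : CellChain f g c (LooseChain.single q) :=
  cons φ (nil g) c.append_nil

/-- Horizontal concatenation. -/
def append : {A B C A' B' C' : X} → {f : A ⟶ A'} → {g : B ⟶ B'} → {h : C ⟶ C'} →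
    {c : LooseChain A B} → {d : LooseChain A' B'} → {c₁ : LooseChain B C} →
    {d₁ : LooseChain B' C'} → CellChain f g c d → CellChain g h c₁ d₁ →
    CellChain f h (c.append c₁) (d.append d₁)
  | _, _, _, _, _, _, _, _, _, _, _, _, _, nil _, Δ => Δ
  | _, _, _, _, _, _, _, _, _, _, _, _, _, cons φ Γ hc, Δ =>
      cons φ (append Γ Δ) (by rw [← hc, LooseChain.append_assoc])

end CellChain

/-- Identity 2-cells and vertical composition (pasting) of 2-cells. The boundaries of a composite
are the composites `f ≫ f'` and `g ≫ g'`; they are allowed to be given by any tight-cells `h`, `k`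
equal to these. -/
class PastingData (X : Type u) extends CellData.{v, w, z} X where
  idCell : ∀ {A B : X} (p : Loose B A), Cell (𝟙 A) (𝟙 B) (LooseChain.single p) p
  vpaste : ∀ {A B A' B' A'' B'' : X} {f : A ⟶ A'} {g : B ⟶ B'} {f' : A' ⟶ A''} {g' : B' ⟶ B''}
    {h : A ⟶ A''} {k : B ⟶ B''} {c : LooseChain A B} {d : LooseChain A' B'} {q : Loose B'' A''},
    CellChain f g c d → Cell f' g' d q → f ≫ f' = h → g ≫ g' = k → Cell h k c q

open PastingData

/-- The chain of identity 2-cells on a chain of loose-cells. -/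
def CellChain.ident {X : Type u} [PastingData.{v, w, z} X] :
    {A B : X} → (c : LooseChain A B) → CellChain (𝟙 A) (𝟙 B) c c
  | _, _, LooseChain.nil A => CellChain.nil (𝟙 A)
  | _, _, LooseChain.cons p c => CellChain.cons (idCell p) (CellChain.ident c) rfl

/-- Two-level pasting diagrams: a chain of 2-cells, each of which comes with a chain of 2-cells
above it. -/
inductive CellGrid {X : Type u} [CellData.{v, w, z} X] :
    ∀ {A B A' B' A'' B'' : X}, (A ⟶ A') → (A' ⟶ A'') → (B ⟶ B') → (B' ⟶ B'') →
      LooseChain A B → LooseChain A' B' → LooseChain A'' B'' → Type (max u v w z)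
  | nil {A A' A'' : X} (f : A ⟶ A') (f' : A' ⟶ A'') :
      CellGrid f f' f f' (LooseChain.nil A) (LooseChain.nil A') (LooseChain.nil A'')
  | cons {A B C A' B' C' A'' B'' C'' : X} {f : A ⟶ A'} {f' : A' ⟶ A''} {g : B ⟶ B'}
      {g' : B' ⟶ B''} {h : C ⟶ C'} {h' : C' ⟶ C''} {c : LooseChain A B} {d : LooseChain A' B'}
      {c₁ : LooseChain B C} {d₁ : LooseChain B' C'} {q : Loose B'' A''} {e : LooseChain B'' C''}
      (Γ : CellChain f g c d) (φ : Cell f' g' d q) (G : CellGrid g g' h h' c₁ d₁ e) :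
      CellGrid f f' h h' (c.append c₁) (d.append d₁) (LooseChain.cons q e)

namespace CellGrid

/-- The upper level of a two-level pasting diagram. -/
def top {X : Type u} [CellData.{v, w, z} X] : {A B A' B' A'' B'' : X} → {f : A ⟶ A'} →
    {f' : A' ⟶ A''} → {g : B ⟶ B'} → {g' : B' ⟶ B''} → {c : LooseChain A B} →
    {d : LooseChain A' B'} → {e : LooseChain A'' B''} → CellGrid f f' g g' c d e →
    CellChain f g c d
  | _, _, _, _, _, _, _, _, _, _, _, _, _, nil f _ => CellChain.nil f
  | _, _, _, _, _, _, _, _, _, _, _, _, _, cons Γ _ G => Γ.append G.top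

/-- The lower level of a two-level pasting diagram. -/
def bottom {X : Type u} [CellData.{v, w, z} X] : {A B A' B' A'' B'' : X} → {f : A ⟶ A'} →
    {f' : A' ⟶ A''} → {g : B ⟶ B'} → {g' : B' ⟶ B''} → {c : LooseChain A B} →
    {d : LooseChain A' B'} → {e : LooseChain A'' B''} → CellGrid f f' g g' c d e →
    CellChain f' g' d e
  | _, _, _, _, _, _, _, _, _, _, _, _, _, nil _ f' => CellChain.nil f'
  | _, _, _, _, _, _, _, _, _, _, _, _, _, cons _ φ G => CellChain.cons φ G.bottom rfl

/-- The chain of the vertical composites of a two-level pasting diagram. -/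
def composite {X : Type u} [PastingData.{v, w, z} X] : {A B A' B' A'' B'' : X} → {f : A ⟶ A'} →
    {f' : A' ⟶ A''} → {g : B ⟶ B'} → {g' : B' ⟶ B''} → {c : LooseChain A B} →
    {d : LooseChain A' B'} → {e : LooseChain A'' B''} → CellGrid f f' g g' c d e →
    CellChain (f ≫ f') (g ≫ g') c e
  | _, _, _, _, _, _, _, _, _, _, _, _, _, nil f f' => CellChain.nil (f ≫ f')
  | _, _, _, _, _, _, _, _, _, _, _, _, _, cons Γ φ G =>
      CellChain.cons (vpaste Γ φ rfl rfl) G.composite rfl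

end CellGrid

/-- Virtual double categories. -/
class VirtualDoubleCategory (X : Type u) extends PastingData.{v, w, z} X where
  id_vpaste : ∀ {A B A' B' : X} {f : A ⟶ A'} {g : B ⟶ B'} {c : LooseChain A B} {q : Loose B' A'}
    (φ : Cell f g c q),
    vpaste (CellChain.ident c) φ (Category.id_comp f) (Category.id_comp g) = φ
  vpaste_id : ∀ {A B A' B' : X} {f : A ⟶ A'} {g : B ⟶ B'} {c : LooseChain A B} {q : Loose B' A'}
    (φ : Cell f g c q),
    vpaste (CellChain.single φ) (idCell q) (Category.comp_id f) (Category.comp_id g) = φ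
  vpaste_assoc : ∀ {A B A' B' A'' B'' A₃ B₃ : X} {f : A ⟶ A'} {f' : A' ⟶ A''} {g : B ⟶ B'}
    {g' : B' ⟶ B''} {f'' : A'' ⟶ A₃} {g'' : B'' ⟶ B₃} {c : LooseChain A B}
    {d : LooseChain A' B'} {e : LooseChain A'' B''} {q : Loose B₃ A₃}
    (G : CellGrid f f' g g' c d e) (φ : Cell f'' g'' e q),
    vpaste G.composite φ (Category.assoc f f' f'') (Category.assoc g g' g'') =
      vpaste G.top (vpaste G.bottom φ rfl rfl) rfl rfl

section VDC

variable {X : Type u} [VirtualDoubleCategory.{v, w, z} X]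

/-- A 2-cell `κ : c ⇒ q` with identity boundaries is opcartesian when every 2-cell with domain
`r, c, s` factors uniquely through it, for all chains `r` and `s`; it then exhibits `q` as the
composite of the chain `c` (a loose-identity, if `c` is empty). -/
def IsOpcartesian {A B : X} {c : LooseChain A B} {q : Loose B A} (κ : Cell (𝟙 A) (𝟙 B) c q) :
    Prop :=
  ∀ {R S R' S' : X} (r : LooseChain R A) (s : LooseChain B S) (f : R ⟶ R') (g : S ⟶ S')
    (t : Loose S' R') (φ : Cell f g (r.append (c.append s)) t),
    ∃! ψ : Cell f g (r.append (LooseChain.cons q s)) t,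
      vpaste ((CellChain.ident r).append (CellChain.cons κ (CellChain.ident s) rfl)) ψ
        (Category.id_comp f) (Category.id_comp g) = φ

/-- A 2-cell `κ : p' ⇒ p` with boundaries `f` and `g` is cartesian when every 2-cell into `p` with
boundaries `h ≫ f` and `k ≫ g` factors uniquely through it; it then exhibits `p'` as the
restriction `p(f, g)`. -/
def IsCartesian {A B A' B' : X} {f : A' ⟶ A} {g : B' ⟶ B} {p' : Loose B' A'} {p : Loose B A}
    (κ : Cell f g (LooseChain.single p') p) : Prop :=
  ∀ {R S : X} (h : R ⟶ A') (k : S ⟶ B') (c : LooseChain R S) (φ : Cell (h ≫ f) (k ≫ g) c p),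
    ∃! ψ : Cell h k c p', vpaste (CellChain.single ψ) κ rfl rfl = φ

/-- Invertibility of a 2-cell between parallel loose-cells. -/
def IsInvertible {A B : X} {p q : Loose B A} (φ : Cell (𝟙 A) (𝟙 B) (LooseChain.single p) q) :
    Prop :=
  ∃ ψ : Cell (𝟙 A) (𝟙 B) (LooseChain.single q) p,
    vpaste (CellChain.single φ) ψ (Category.id_comp _) (Category.id_comp _) = idCell p ∧
    vpaste (CellChain.single ψ) φ (Category.id_comp _) (Category.id_comp _) = idCell q

end VDC

/-! ## Virtual equipments -/

/-- Virtual equipments: virtual double categories with loose-identities `A(1, 1)` and restrictions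
`p(f, g)`. -/
class VirtualEquipment (X : Type u) extends VirtualDoubleCategory.{v, w, z} X where
  unit : ∀ A : X, Loose A A
  unitCell : ∀ A : X, Cell (𝟙 A) (𝟙 A) (LooseChain.nil A) (unit A)
  unitCell_opcartesian : ∀ A : X, IsOpcartesian (X := X) (unitCell A)
  restr : ∀ {A B A' B' : X}, Loose B A → (A' ⟶ A) → (B' ⟶ B) → Loose B' A'
  restrCell : ∀ {A B A' B' : X} (p : Loose B A) (f : A' ⟶ A) (g : B' ⟶ B),
    Cell f g (LooseChain.single (restr p f g)) p
  restrCell_cartesian : ∀ {A B A' B' : X} (p : Loose B A) (f : A' ⟶ A) (g : B' ⟶ B),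
    IsCartesian (X := X) (restrCell p f g)

open VirtualEquipment

noncomputable section Equipment

variable {X : Type u} [VirtualEquipment.{v, w, z} X]

/-- The loose-cell `E(f, g) : B ⇸ A`, for tight-cells `f : A ⟶ E` and `g : B ⟶ E`. -/
def hom {A B E : X} (f : A ⟶ E) (g : B ⟶ E) : Loose B A := restr (unit E) f g

/-- The cartesian 2-cell `E(f, g) ⇒ E(1, 1)` with boundaries `f` and `g`. -/
def homCell {A B E : X} (f : A ⟶ E) (g : B ⟶ E) : Cell f g (LooseChain.single (hom f g)) (unit E) :=
  restrCell (unit E) f g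

/-- The factorisation through `E(f, g)` of a 2-cell into `E(1, 1)`. -/
def homLift {R S A B E : X} {f : A ⟶ E} {g : B ⟶ E} {h : R ⟶ A} {k : S ⟶ B} {f₁ : R ⟶ E}
    {g₁ : S ⟶ E} {c : LooseChain R S} (φ : Cell f₁ g₁ c (unit E)) (hf : h ≫ f = f₁)
    (hg : k ≫ g = g₁) : Cell h k c (hom f g) :=
  (restrCell_cartesian (unit E) f g h k c
    (vpaste (CellChain.ident c) φ (by rw [hf, Category.id_comp])
      (by rw [hg, Category.id_comp]))).choose

/-- The 2-cell `E(1, 1), E(1, 1) ⇒ E(1, 1)` whose composite with the opcartesian 2-cell into the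
first factor is the identity. -/
def unitMul (E : X) :
    Cell (𝟙 E) (𝟙 E) (LooseChain.cons (unit E) (LooseChain.single (unit E))) (unit E) :=
  (unitCell_opcartesian E (LooseChain.nil E) (LooseChain.single (unit E)) (𝟙 E) (𝟙 E) (unit E)
    (idCell (unit E))).choose

/-- The 2-cell `D(1, 1) ⇒ E(1, 1)` with both boundaries `u : D ⟶ E`, given by the action of `u`
on loose-identities. -/
def unitMap {D E : X} (u : D ⟶ E) : Cell u u (LooseChain.single (unit D)) (unit E) :=
  (unitCell_opcartesian D (LooseChain.nil D) (LooseChain.nil D) u u (unit E)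
    (vpaste (CellChain.nil u) (unitCell E) (Category.comp_id u) (Category.comp_id u))).choose

/-- The composition 2-cell `E(f, g), E(g, h) ⇒ E(f, h)`. -/
def homComp {A B C E : X} (f : A ⟶ E) (g : B ⟶ E) (h : C ⟶ E) :
    Cell (𝟙 A) (𝟙 C) (LooseChain.cons (hom f g) (LooseChain.single (hom g h))) (hom f h) :=
  homLift
    (vpaste (CellChain.cons (homCell f g) (CellChain.single (homCell g h)) rfl) (unitMul E)
      (Category.comp_id f) (Category.comp_id h))
    (Category.id_comp f) (Category.id_comp h)

/-- The identity 2-cell `⇒ E(f, f)` of a tight-cell `f`. -/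
def homId {A E : X} (f : A ⟶ E) : Cell (𝟙 A) (𝟙 A) (LooseChain.nil A) (hom f f) :=
  homLift (vpaste (CellChain.nil f) (unitCell E) (Category.comp_id f) (Category.comp_id f))
    (Category.id_comp f) (Category.id_comp f)

/-- The action `D(a, b) ⇒ E(a ≫ u, b ≫ u)` of a tight-cell `u : D ⟶ E`. -/
def homMap {A B D E : X} (u : D ⟶ E) {a : A ⟶ D} {b : B ⟶ D} {a' : A ⟶ E} {b' : B ⟶ E}
    (ha : a ≫ u = a') (hb : b ≫ u = b') :
    Cell (𝟙 A) (𝟙 B) (LooseChain.single (hom a b)) (hom a' b') :=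
  homLift (vpaste (CellChain.single (homCell a b)) (unitMap u) ha hb)
    (Category.id_comp a') (Category.id_comp b')

/-- Postcomposition of a 2-cell `φ : c ⇒ D(a, b)` with a tight-cell `u : D ⟶ E`. -/
def whisker {A B D E : X} (u : D ⟶ E) {a : A ⟶ D} {b : B ⟶ D} {a' : A ⟶ E} {b' : B ⟶ E}
    (ha : a ≫ u = a') (hb : b ≫ u = b') {c : LooseChain A B}
    (φ : Cell (𝟙 A) (𝟙 B) c (hom a b)) : Cell (𝟙 A) (𝟙 B) c (hom a' b') :=
  vpaste (CellChain.single φ) (homMap u ha hb) (Category.id_comp _) (Category.id_comp _)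

/-- The composite `f ⇒ g ⇒ h` in the graded sense: 2-cells `c ⇒ E(f, g)` and `d ⇒ E(g, h)` paste
to a 2-cell `c, d ⇒ E(f, h)`. -/
def paste {A B C E : X} {f : A ⟶ E} {g : B ⟶ E} {h : C ⟶ E} {c : LooseChain A B}
    {d : LooseChain B C} (φ : Cell (𝟙 A) (𝟙 B) c (hom f g)) (ψ : Cell (𝟙 B) (𝟙 C) d (hom g h)) :
    Cell (𝟙 A) (𝟙 C) (c.append d) (hom f h) :=
  vpaste (CellChain.cons φ (CellChain.single ψ) rfl) (homComp f g h)
    (Category.id_comp _) (Category.id_comp _)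

/-- The vertical composite of `φ : c ⇒ p` and `ψ : p ⇒ q`. -/
def vcomp {A B : X} {c : LooseChain A B} {p q : Loose B A} (φ : Cell (𝟙 A) (𝟙 B) c p)
    (ψ : Cell (𝟙 A) (𝟙 B) (LooseChain.single p) q) : Cell (𝟙 A) (𝟙 B) c q :=
  vpaste (CellChain.single φ) ψ (Category.id_comp _) (Category.id_comp _)

/-- For a 2-cell `α : E(j, u) ⇒ E(t, u)` and a tight-cell `x` with `x ≫ u = e`, the restricted
2-cell `α(1, x) : E(j, e) ⇒ E(t, e)`. -/
def restrExt {A D D' E : X} {j t : A ⟶ E} {u : D ⟶ E}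
    (α : Cell (𝟙 A) (𝟙 D) (LooseChain.single (hom j u)) (hom t u))
    {x : D' ⟶ D} {e : D' ⟶ E} (hx : x ≫ u = e) :
    Cell (𝟙 A) (𝟙 D') (LooseChain.single (hom j e)) (hom t e) :=
  homLift
    (vpaste
      (CellChain.single
        (vpaste
          (CellChain.single (homLift (homCell j e) (Category.id_comp j) hx :
            Cell (𝟙 A) x (LooseChain.single (hom j e)) (hom j u)))
          α (Category.id_comp (𝟙 A)) (Category.comp_id x)))
      (homCell t u) (Category.id_comp t) hx)
    (Category.id_comp t) (Category.id_comp e)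

/-! ## Weighted colimits and their creation -/

/-- A `p`-cocone for `f`: a tight-cell `pt : Y ⟶ W` and a 2-cell `p ⇒ W(f, pt)`. -/
structure Cocone {Y Z W : X} (p : Loose Y Z) (f : Z ⟶ W) where
  pt : Y ⟶ W
  cell : Cell (𝟙 Z) (𝟙 Y) (LooseChain.single p) (hom f pt)

namespace Cocone

variable {Y Z W : X} {p : Loose Y Z} {f : Z ⟶ W}

/-- A `p`-cocone is the `p`-weighted colimit of `f` when pasting with it is a bijection from
2-cells `q₁, …, qₙ ⇒ W(pt, 1)` to 2-cells `p, q₁, …, qₙ ⇒ W(f, 1)`. -/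
def IsColimit (k : Cocone p f) : Prop :=
  ∀ q : LooseChain Y W, Function.Bijective
    (fun ψ : Cell (𝟙 Y) (𝟙 W) q (hom k.pt (𝟙 W)) =>
      (paste k.cell ψ : Cell (𝟙 Z) (𝟙 W) (LooseChain.cons p q) (hom f (𝟙 W))))

/-- The canonical 2-cell `W(j, f), p ⇒ W(j, pt)`. -/
def canonicalCell {A : X} (j : A ⟶ W) (k : Cocone p f) :
    Cell (𝟙 A) (𝟙 Y) (LooseChain.cons (hom j f) (LooseChain.single p)) (hom j k.pt) :=
  paste (idCell (hom j f)) k.cell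

/-- A cocone is `j`-absolute when the composite `W(j, f) ⊙ p` exists and the canonical 2-cell
`W(j, f) ⊙ p ⇒ W(j, pt)` is invertible. -/
def IsAbsolute {A : X} (j : A ⟶ W) (k : Cocone p f) : Prop :=
  ∃ (q : Loose Y A)
    (κ : Cell (𝟙 A) (𝟙 Y) (LooseChain.cons (hom j f) (LooseChain.single p)) q)
    (φ : Cell (𝟙 A) (𝟙 Y) (LooseChain.single q) (hom j k.pt)),
    IsOpcartesian κ ∧ vcomp κ φ = k.canonicalCell j ∧ IsInvertible φ

/-- `k'` is sent to `k` by postcomposition with `g`. -/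
def IsLiftOf {V : X} {g : W ⟶ V} (k' : Cocone p f) (k : Cocone p (f ≫ g)) : Prop :=
  ∃ h : k'.pt ≫ g = k.pt, whisker g rfl h k'.cell = k.cell

/-- A colimit cocone `k` for `f ≫ g` is strictly created by `g` when there is a unique cocone for
`f` that is sent by `g` to `k`, and this cocone is a colimit. -/
def IsStrictlyCreated {V : X} {g : W ⟶ V} (k : Cocone p (f ≫ g)) : Prop :=
  ∃ k' : Cocone p f,
    (k'.IsLiftOf k ∧ ∀ k'' : Cocone p f, k''.IsLiftOf k → k'' = k') ∧ k'.IsColimit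

end Cocone

/-- The tight-cell `g : W ⟶ V` strictly creates `j`-absolute colimits. -/
def StrictlyCreatesAbsoluteColimits {A W V : X} (j : A ⟶ V) (g : W ⟶ V) : Prop :=
  ∀ {Y Z : X} (p : Loose Y Z) (f : Z ⟶ W) (k : Cocone p (f ≫ g)),
    k.IsColimit → k.IsAbsolute j → k.IsStrictlyCreated

/-! ## Relative monads and algebra objects -/

/-- A `j`-relative monad: a carrier `t`, an extension operator `E(j, t) ⇒ E(t, t)` and a unit
`j ⇒ t` (a 2-cell `⇒ E(j, t)`), satisfying the unit and associativity laws. -/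
structure RelativeMonad {A E : X} (j : A ⟶ E) where
  carrier : A ⟶ E
  ext : Cell (𝟙 A) (𝟙 A) (LooseChain.single (hom j carrier)) (hom carrier carrier)
  unit : Cell (𝟙 A) (𝟙 A) (LooseChain.nil A) (hom j carrier)
  unit_ext : vcomp unit ext = homId carrier
  unit_paste_ext : paste unit ext = idCell (hom j carrier)
  assoc : vcomp (paste (idCell (hom j carrier)) ext) ext = paste ext ext

namespace RelativeMonad

variable {A E : X} {j : A ⟶ E}

/-- An algebra with domain `D` for a relative monad: a carrier `e : D ⟶ E` and an extension
operator `E(j, e) ⇒ E(t, e)` compatible with those of the monad. -/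
structure Algebra (T : RelativeMonad j) (D : X) where
  carrier : D ⟶ E
  ext : Cell (𝟙 A) (𝟙 D) (LooseChain.single (hom j carrier)) (hom T.carrier carrier)
  unit_law : paste T.unit ext = idCell (hom j carrier)
  ext_law : vcomp (paste (idCell (hom j T.carrier)) ext) ext = paste T.ext ext

variable {T : RelativeMonad j}

/-- Graded algebra morphisms: 2-cells `ε : p₁, …, pₙ ⇒ E(e, e')` compatible with the extension
operators, as 2-cells `E(j, e), p₁, …, pₙ ⇒ E(t, e')`. -/
def Algebra.IsGradedMorphism {D D' : X} (a : T.Algebra D) (a' : T.Algebra D')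
    {p : LooseChain D D'} (ε : Cell (𝟙 D) (𝟙 D') p (hom a.carrier a'.carrier)) : Prop :=
  vcomp (paste (idCell (hom j a.carrier)) ε) a'.ext = paste a.ext ε

/-- The algebra structure of `a` is obtained from that of `U` by restriction along `x`. -/
def Algebra.IsRestriction {D D' : X} (U : T.Algebra D) (a : T.Algebra D') (x : D' ⟶ D) : Prop :=
  ∃ hx : x ≫ U.carrier = a.carrier, restrExt U.ext hx = a.ext

/-- Algebra objects: every algebra is the restriction of `U` along a unique tight-cell, and every
graded algebra morphism is the postcomposition by the carrier of `U` of a unique 2-cell between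
the corresponding tight-cells. -/
structure IsAlgebraObject {D : X} (U : T.Algebra D) : Prop where
  existsUnique_tight : ∀ {C : X} (a : T.Algebra C), ∃! x : C ⟶ D, U.IsRestriction a x
  existsUnique_cell : ∀ {C C' : X} (a : T.Algebra C) (a' : T.Algebra C') (x : C ⟶ D) (x' : C' ⟶ D)
    (hx : x ≫ U.carrier = a.carrier) (hx' : x' ≫ U.carrier = a'.carrier),
    restrExt U.ext hx = a.ext → restrExt U.ext hx' = a'.ext → ∀ (p : LooseChain C C')
    (ε : Cell (𝟙 C) (𝟙 C') p (hom a.carrier a'.carrier)), a.IsGradedMorphism a' ε →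
    ∃! ψ : Cell (𝟙 C) (𝟙 C') p (hom x x'), whisker U.carrier hx hx' ψ = ε

end RelativeMonad

end Equipment

end FormalCat

/-! Write `u` for the carrier of the algebra object and let `(w, λ)` be a `j`-absolute colimit of `f
≫ u` weighted by `p`. Restricting the generic algebra along `f` makes `f ≫ u` an algebra. By
absoluteness the canonical 2-cell `E(j, f ≫ u), p ⇒ E(j, w)` is opcartesian
(`Cocone.IsAbsolute.isOpcartesian`), so the extension operator of `f ≫ u` pasted with `λ` factors
uniquely through it, as some `θ : E(j, w) ⇒ E(t, w)`. The algebra laws for `θ` may be tested after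
the canonical 2-cell, where they become those of `f ≫ u` (`Algebra.ofCocone`). The equation defining
`θ` says that `λ` is a graded morphism, so the algebra object lifts `(w, λ)` to a cocone `(x, l)`
for `f`.

The lift is unique: postcomposition with `u` always yields graded morphisms
(`vcomp_paste_whisker_restrExt`), so any lift induces on `w` an extension operator solving the
equation for `θ`, and the algebra object determines the rest.

The lift is a colimit: 2-cells `q ⇒ Alg(T)(x, 1)` are graded morphisms `q ⇒ E(w, u)`, and 2-cells
`p, q ⇒ Alg(T)(f, 1)` are graded morphisms `p, q ⇒ E(f ≫ u, u)`. Pasting with `λ` is a bijection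
between all 2-cells of these two kinds, by the universal property of `w` transposed along the
companion of `u` (`Cocone.IsColimit.bijective`). It reflects gradedness, again because the canonical
2-cell is opcartesian (`isGradedMorphism_of_paste`).

The calculations rest on one reduction: a 2-cell into `E(f, g)` is the same as a 2-cell into `E(1,
1)` with boundaries `f` and `g` (`toUnit`, `homLift`), where pasting becomes the unital and
associative operation `unitComp`. -/

namespace FormalCat

open LooseData CellData PastingData VirtualDoubleCategory

/-! ### Chains of 2-cells and their vertical composites -/

section VDC

variable {X : Type u}

/-- Horizontal concatenation, with prescribed domain and codomain. -/
def CellChain.appendOfEq [CellData.{v, w, z} X] {A B C A' B' C' : X} {f : A ⟶ A'} {g : B ⟶ B'}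
    {h : C ⟶ C'} {c : LooseChain A B} {d : LooseChain A' B'} {c₁ : LooseChain B C}
    {d₁ : LooseChain B' C'} {c₂ : LooseChain A C} {d₂ : LooseChain A' C'}
    (Γ : CellChain f g c d) (Δ : CellChain g h c₁ d₁) (hc : c.append c₁ = c₂)
    (hd : d.append d₁ = d₂) : CellChain f h c₂ d₂ :=
  hc ▸ hd ▸ Γ.append Δ

theorem CellChain.cons_appendOfEq [CellData.{v, w, z} X] {A B C D A' B' C' D' : X} {f : A ⟶ A'}
    {g : B ⟶ B'} {h : C ⟶ C'} {k : D ⟶ D'} {c : LooseChain A B} {q : Loose B' A'}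
    {c₁ : LooseChain B C} {c₂ : LooseChain A C} {d₁ : LooseChain B' C'} {e : LooseChain C D}
    {e' : LooseChain C' D'} {a : LooseChain A D} {a' : LooseChain B' D'} {b : LooseChain B D}
    (φ : Cell f g c q) (Γ : CellChain g h c₁ d₁) (hc : c.append c₁ = c₂)
    (Δ : CellChain h k e e') (ha : c₂.append e = a) (ha' : d₁.append e' = a')
    (hb : c₁.append e = b) (hcb : c.append b = a) :
    (CellChain.cons φ Γ hc).appendOfEq Δ ha (congrArg (LooseChain.cons q) ha') =
      CellChain.cons φ (Γ.appendOfEq Δ hb ha') hcb := by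
  subst ha' hb hc ha
  rfl

theorem CellChain.appendOfEq_nil [CellData.{v, w, z} X] {A B A' B' : X} {f : A ⟶ A'} {g : B ⟶ B'}
    {c : LooseChain A B} {d : LooseChain A' B'} (Γ : CellChain f g c d) :
    Γ.appendOfEq (CellChain.nil g) c.append_nil d.append_nil = Γ := by
  induction Γ with
  | nil f => rfl
  | cons φ Γ hc ih =>
    rw [CellChain.cons_appendOfEq φ Γ hc (CellChain.nil _) _ (LooseChain.append_nil _)
      (LooseChain.append_nil _) hc, ih]

theorem CellChain.ident_append [VirtualDoubleCategory.{v, w, z} X] {A B C : X}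
    (c : LooseChain A B) (d : LooseChain B C) :
    (CellChain.ident c).append (CellChain.ident d) = CellChain.ident (c.append d) := by
  induction c with
  | nil => rfl
  | cons p c ih =>
    exact congrArg (fun Γ => CellChain.cons (idCell p) Γ rfl) (ih d)

variable [VirtualDoubleCategory.{v, w, z} X]

/-- `Θ` is the vertical composite of the chains of 2-cells `Γ` and `Δ`. -/
def CellChain.IsComp {A B A' B' A'' B'' : X} {f : A ⟶ A'} {f' : A' ⟶ A''} {g : B ⟶ B'}
    {g' : B' ⟶ B''} {h : A ⟶ A''} {k : B ⟶ B''} {c : LooseChain A B} {d : LooseChain A' B'}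
    {e : LooseChain A'' B''} (Γ : CellChain f g c d) (Δ : CellChain f' g' d e)
    (Θ : CellChain h k c e) : Prop :=
  ∃ (hf : f ≫ f' = h) (hg : g ≫ g' = k) (G : CellGrid f f' g g' c d e),
    G.top = Γ ∧ G.bottom = Δ ∧ hf ▸ hg ▸ G.composite = Θ

namespace CellChain.IsComp

theorem nil {A A' A'' : X} {f : A ⟶ A'} {f' : A' ⟶ A''} {h : A ⟶ A''} (hf : f ≫ f' = h) :
    IsComp (CellChain.nil f) (CellChain.nil f') (CellChain.nil h) := by
  subst hf
  exact ⟨rfl, rfl, CellGrid.nil f f', rfl, rfl, rfl⟩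

/-- The relation `IsComp` absorbs the equalities between boundaries and between concatenated chains,
which hold only propositionally. Associativity of pasting can then be applied with no transport left
in the conclusion. -/
theorem cons {A B C A' B' C' A'' B'' C'' : X} {f : A ⟶ A'}
    {f' : A' ⟶ A''} {g : B ⟶ B'} {g' : B' ⟶ B''} {h : C ⟶ C'} {h' : C' ⟶ C''} {m : A ⟶ A''}
    {n : B ⟶ B''} {l : C ⟶ C''} {c : LooseChain A B} {d : LooseChain A' B'}
    {c₁ : LooseChain B C} {d₁ : LooseChain B' C'} {c₂ : LooseChain A C} {d₂ : LooseChain A' C'}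
    {q : Loose B'' A''} {e : LooseChain B'' C''} (Γ : CellChain f g c d) (φ : Cell f' g' d q)
    {Γ₁ : CellChain g h c₁ d₁} {Δ₁ : CellChain g' h' d₁ e} {Θ₁ : CellChain n l c₁ e}
    (H : IsComp Γ₁ Δ₁ Θ₁) (hm : f ≫ f' = m) (hn : g ≫ g' = n) (hc : c.append c₁ = c₂)
    (hd : d.append d₁ = d₂) :
    IsComp (Γ.appendOfEq Γ₁ hc hd) (CellChain.cons φ Δ₁ hd)
      (CellChain.cons (vpaste Γ φ hm hn) Θ₁ hc) := by
  obtain ⟨_, rfl, G, rfl, rfl, rfl⟩ := H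
  subst hm hn hc hd
  exact ⟨rfl, rfl, CellGrid.cons Γ φ G, rfl, rfl, rfl⟩

theorem single {A B A' B' A'' B'' : X} {f : A ⟶ A'}
    {f' : A' ⟶ A''} {g : B ⟶ B'} {g' : B' ⟶ B''} {m : A ⟶ A''}
    {n : B ⟶ B''} {c : LooseChain A B} {d : LooseChain A' B'}
    {q : Loose B'' A''} (Γ : CellChain f g c d) (φ : Cell f' g' d q)
    (hm : f ≫ f' = m) (hn : g ≫ g' = n) :
    IsComp Γ (CellChain.single φ) (CellChain.single (vpaste Γ φ hm hn)) := by
  have := cons Γ φ (nil hn) hm hn c.append_nil d.append_nil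
  rwa [CellChain.appendOfEq_nil] at this

theorem pair {A B C A' B' C' A'' B'' C'' : X} {f : A ⟶ A'}
    {f' : A' ⟶ A''} {g : B ⟶ B'} {g' : B' ⟶ B''} {h : C ⟶ C'} {h' : C' ⟶ C''} {m : A ⟶ A''}
    {n : B ⟶ B''} {l : C ⟶ C''} {c : LooseChain A B} {d : LooseChain A' B'}
    {c₁ : LooseChain B C} {d₁ : LooseChain B' C'} {c₂ : LooseChain A C} {d₂ : LooseChain A' C'}
    {q : Loose B'' A''} {q₁ : Loose C'' B''} (Γ : CellChain f g c d) (φ : Cell f' g' d q)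
    (Γ₁ : CellChain g h c₁ d₁) (φ₁ : Cell g' h' d₁ q₁)
    (hm : f ≫ f' = m) (hn : g ≫ g' = n) (hl : h ≫ h' = l) (hc : c.append c₁ = c₂)
    (hd : d.append d₁ = d₂) :
    IsComp (Γ.appendOfEq Γ₁ hc hd) (CellChain.cons φ (CellChain.single φ₁) hd)
      (CellChain.cons (vpaste Γ φ hm hn) (CellChain.single (vpaste Γ₁ φ₁ hn hl)) hc) :=
  cons Γ φ (single Γ₁ φ₁ hn hl) hm hn hc hd

/-- Prefixing identity 2-cells. -/
theorem ident_append {A B C C' C'' : X} (r : LooseChain A B) {h : C ⟶ C'} {h' : C' ⟶ C''}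
    {l : C ⟶ C''} {c : LooseChain B C} {d : LooseChain B C'} {e : LooseChain B C''}
    {Γ : CellChain (𝟙 B) h c d} {Δ : CellChain (𝟙 B) h' d e} {Θ : CellChain (𝟙 B) l c e}
    (H : IsComp Γ Δ Θ) :
    IsComp ((CellChain.ident r).append Γ) ((CellChain.ident r).append Δ)
      ((CellChain.ident r).append Θ) := by
  induction r with
  | nil => exact H
  | cons p r ih =>
    have := cons (CellChain.single (idCell p)) (idCell p) (ih H) (Category.comp_id _)
      (Category.comp_id _) rfl rfl
    -- The new head is an identity pasted with an identity, which collapses to a single identity.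
    rwa [vpaste_id] at this

theorem ident {A B : X} (r : LooseChain A B) :
    IsComp (CellChain.ident r) (CellChain.ident r) (CellChain.ident r) := by
  have := ident_append r (nil (Category.comp_id (𝟙 B)))
  have h : (CellChain.ident r).append (CellChain.nil (𝟙 B)) =
    CellChain.ident (r.append (LooseChain.nil B)) := CellChain.ident_append r (LooseChain.nil B)
  rw [h, LooseChain.append_nil] at this
  exact this

/-- Vertical composites of chains are compatible with pasting. -/
theorem vpaste_vpaste {A B A' B' A'' B'' A₃ B₃ : X} {f : A ⟶ A'} {f' : A' ⟶ A''} {g : B ⟶ B'}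
    {g' : B' ⟶ B''} {h : A ⟶ A''} {k : B ⟶ B''} {c : LooseChain A B} {d : LooseChain A' B'}
    {e : LooseChain A'' B''} {Γ : CellChain f g c d} {Δ : CellChain f' g' d e}
    {Θ : CellChain h k c e} (H : IsComp Γ Δ Θ) {f'' : A'' ⟶ A₃} {g'' : B'' ⟶ B₃} {q : Loose B₃ A₃}
    {a : A ⟶ A₃} {b : B ⟶ B₃} {m : A' ⟶ A₃} {n : B' ⟶ B₃}
    (φ : Cell f'' g'' e q) (ha : h ≫ f'' = a) (hb : k ≫ g'' = b) (hm : f' ≫ f'' = m)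
    (hn : g' ≫ g'' = n) (ha' : f ≫ m = a) (hb' : g ≫ n = b) :
    vpaste Γ (vpaste Δ φ hm hn) ha' hb' = vpaste Θ φ ha hb := by
  obtain ⟨rfl, rfl, G, rfl, rfl, rfl⟩ := H
  subst hm hn ha' hb'
  exact (vpaste_assoc G φ).symm

end CellChain.IsComp

end VDC
end FormalCat

/-! ### Opcartesian 2-cells and small cases of associativity -/

namespace FormalCat

open LooseData CellData PastingData VirtualDoubleCategory VirtualEquipment

theorem LooseChain.single_append {X : Type u} [LooseData.{v, w} X] {A B C : X} (p : Loose B A)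
    (c : LooseChain B C) : (LooseChain.single p).append c = LooseChain.cons p c :=
  rfl

section VDC

variable {X : Type u} [VirtualDoubleCategory.{v, w, z} X]

/-- Whiskering a globular 2-cell by identities on both sides is functorial. -/
theorem vpaste_whiskered {A B R S R' S' : X} {c : LooseChain A B} {p q : Loose B A}
    (κ : Cell (𝟙 A) (𝟙 B) c p) (φ : Cell (𝟙 A) (𝟙 B) (LooseChain.single p) q)
    (r : LooseChain R A) (s : LooseChain B S) {f : R ⟶ R'} {g : S ⟶ S'} {t : Loose S' R'}
    (ψ : Cell f g (r.append (LooseChain.cons q s)) t) :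
    vpaste ((CellChain.ident r).append (CellChain.cons κ (CellChain.ident s) rfl))
      (vpaste ((CellChain.ident r).append (CellChain.cons φ (CellChain.ident s) rfl)) ψ
        (Category.id_comp f) (Category.id_comp g)) (Category.id_comp f) (Category.id_comp g) =
    vpaste ((CellChain.ident r).append (CellChain.cons
      (vpaste (CellChain.single κ) φ (Category.id_comp _) (Category.id_comp _))
      (CellChain.ident s) rfl)) ψ (Category.id_comp f) (Category.id_comp g) :=
  (CellChain.IsComp.ident_append r (CellChain.IsComp.cons (CellChain.single κ) φ
    (CellChain.IsComp.ident s) (Category.id_comp _) (Category.id_comp _) rfl rfl)).vpaste_vpaste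
    ψ _ _ _ _ _ _

theorem vpaste_whiskered_idCell {A B R S R' S' : X} {q : Loose B A}
    (r : LooseChain R A) (s : LooseChain B S) {f : R ⟶ R'} {g : S ⟶ S'} {t : Loose S' R'}
    (ψ : Cell f g (r.append (LooseChain.cons q s)) t) :
    vpaste ((CellChain.ident r).append (CellChain.cons (idCell q) (CellChain.ident s) rfl)) ψ
      (Category.id_comp f) (Category.id_comp g) = ψ := by
  have h := CellChain.ident_append r (LooseChain.cons q s)
  exact (congrArg (fun Γ => vpaste Γ ψ (Category.id_comp f) (Category.id_comp g)) h).trans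
    (id_vpaste ψ)

/-- The composite of an opcartesian 2-cell and an invertible one is opcartesian. -/
theorem IsOpcartesian.vpaste_isInvertible {A B : X} {c : LooseChain A B} {p q : Loose B A}
    {κ : Cell (𝟙 A) (𝟙 B) c p} (hκ : IsOpcartesian κ)
    {φ : Cell (𝟙 A) (𝟙 B) (LooseChain.single p) q} (hφ : IsInvertible φ) :
    IsOpcartesian
      (vpaste (CellChain.single κ) φ (Category.id_comp (𝟙 A)) (Category.id_comp (𝟙 B))) := by
  obtain ⟨φ', h₁, h₂⟩ := hφ
  intro R S R' S' r s f g t χ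
  obtain ⟨ψ, hψ, hu⟩ := hκ r s f g t χ
  -- Factor through `κ`, then precompose with the inverse of `φ`; the two inverse laws give
  -- existence and uniqueness respectively.
  refine ⟨vpaste ((CellChain.ident r).append (CellChain.cons φ' (CellChain.ident s) rfl)) ψ
    (Category.id_comp f) (Category.id_comp g), ?_, ?_⟩
  · have e := vpaste_whiskered φ φ' r s ψ
    rw [h₁] at e
    refine (vpaste_whiskered κ φ r s _).symm.trans (Eq.trans ?_ hψ)
    exact congrArg (fun θ => vpaste _ θ (Category.id_comp f) (Category.id_comp g))
      (e.trans (vpaste_whiskered_idCell r s ψ))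
  · intro ψ' hψ'
    have e := vpaste_whiskered φ' φ r s ψ'
    rw [h₂] at e
    have e' := hu _ ((vpaste_whiskered κ φ r s ψ').trans hψ')
    rw [← e']
    exact (e.trans (vpaste_whiskered_idCell r s ψ')).symm

/-- This and the next two lemmas are associativity of pasting for a middle level made of one, two or
no 2-cells, the only shapes needed for computing in `E(1, 1)`. -/
theorem vpaste_single_vpaste {A B A' B' A'' B'' A₃ B₃ : X} {f : A ⟶ A'} {f' : A' ⟶ A''}
    {g : B ⟶ B'} {g' : B' ⟶ B''} {h : A ⟶ A''} {k : B ⟶ B''} {c : LooseChain A B}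
    {d : LooseChain A' B'} {p : Loose B'' A''} (Γ : CellChain f g c d) (φ : Cell f' g' d p)
    {f'' : A'' ⟶ A₃} {g'' : B'' ⟶ B₃} {q : Loose B₃ A₃} {a : A ⟶ A₃} {b : B ⟶ B₃} {m : A' ⟶ A₃}
    {n : B' ⟶ B₃} (ψ : Cell f'' g'' (LooseChain.single p) q) (hf : f ≫ f' = h) (hg : g ≫ g' = k)
    (ha : h ≫ f'' = a) (hb : k ≫ g'' = b) (hm : f' ≫ f'' = m)
    (hn : g' ≫ g'' = n) (ha' : f ≫ m = a) (hb' : g ≫ n = b) :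
    vpaste Γ (vpaste (CellChain.single φ) ψ hm hn) ha' hb' =
      vpaste (CellChain.single (vpaste Γ φ hf hg)) ψ ha hb :=
  (CellChain.IsComp.single Γ φ hf hg).vpaste_vpaste ψ _ _ _ _ _ _

theorem vpaste_pair_vpaste {A B C A' B' C' A'' B'' C'' A₃ C₃ : X} {f : A ⟶ A'}
    {f' : A' ⟶ A''} {g : B ⟶ B'} {g' : B' ⟶ B''} {h : C ⟶ C'} {h' : C' ⟶ C''} {m : A ⟶ A''}
    {n : B ⟶ B''} {l : C ⟶ C''} {c : LooseChain A B} {d : LooseChain A' B'}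
    {c₁ : LooseChain B C} {d₁ : LooseChain B' C'} {c₂ : LooseChain A C} {d₂ : LooseChain A' C'}
    {q : Loose B'' A''} {q₁ : Loose C'' B''} (Γ : CellChain f g c d) (φ : Cell f' g' d q)
    (Γ₁ : CellChain g h c₁ d₁) (φ₁ : Cell g' h' d₁ q₁)
    (hm : f ≫ f' = m) (hn : g ≫ g' = n) (hl : h ≫ h' = l) (hc : c.append c₁ = c₂)
    (hd : d.append d₁ = d₂)
    {f'' : A'' ⟶ A₃} {h'' : C'' ⟶ C₃} {t : Loose C₃ A₃} {a : A ⟶ A₃} {b : C ⟶ C₃} {a' : A' ⟶ A₃}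
    {b' : C' ⟶ C₃} (ψ : Cell f'' h'' (LooseChain.cons q (LooseChain.single q₁)) t)
    (ha : m ≫ f'' = a) (hb : l ≫ h'' = b) (hm' : f' ≫ f'' = a') (hl' : h' ≫ h'' = b')
    (ha' : f ≫ a' = a) (hb' : h ≫ b' = b) :
    vpaste (Γ.appendOfEq Γ₁ hc hd) (vpaste (CellChain.cons φ (CellChain.single φ₁) hd) ψ hm' hl')
      ha' hb' =
      vpaste (CellChain.cons (vpaste Γ φ hm hn) (CellChain.single (vpaste Γ₁ φ₁ hn hl)) hc) ψ
        ha hb :=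
  (CellChain.IsComp.pair Γ φ Γ₁ φ₁ hm hn hl hc hd).vpaste_vpaste ψ _ _ _ _ _ _

theorem vpaste_nil_vpaste {A A' A'' A₃ B₃ : X} {f : A ⟶ A'} {f' : A' ⟶ A''} {h : A ⟶ A''}
    {f'' : A'' ⟶ A₃} {g'' : A'' ⟶ B₃} {t : Loose B₃ A₃} {a : A ⟶ A₃} {b : A ⟶ B₃} {a' : A' ⟶ A₃}
    {b' : A' ⟶ B₃} (ψ : Cell f'' g'' (LooseChain.nil A'') t) (hf : f ≫ f' = h)
    (ha : h ≫ f'' = a) (hb : h ≫ g'' = b) (hm : f' ≫ f'' = a') (hn : f' ≫ g'' = b')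
    (ha' : f ≫ a' = a) (hb' : f ≫ b' = b) :
    vpaste (CellChain.nil f) (vpaste (CellChain.nil f') ψ hm hn) ha' hb' =
      vpaste (CellChain.nil h) ψ ha hb :=
  (CellChain.IsComp.nil hf).vpaste_vpaste ψ _ _ _ _ _ _

/-- Pasting an identity 2-cell to the domain of `φ`. -/
theorem vpaste_single_idCell {A B A' B' : X} {f : A ⟶ A'} {g : B ⟶ B'} {p : Loose B A}
    {q : Loose B' A'} (φ : Cell f g (LooseChain.single p) q) :
    vpaste (CellChain.single (idCell p)) φ (Category.id_comp f) (Category.id_comp g) = φ :=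
  id_vpaste φ

end VDC

/-! ### The loose-identity as a monoid -/

section Equipment

variable {X : Type u} [VirtualEquipment.{v, w, z} X]

/-- Composition of 2-cells into a loose-identity. -/
noncomputable def unitComp {A B C E : X} {f : A ⟶ E} {g : B ⟶ E} {h : C ⟶ E} {c : LooseChain A B}
    {d : LooseChain B C} {e : LooseChain A C} (φ : Cell f g c (unit E)) (ψ : Cell g h d (unit E))
    (he : c.append d = e) : Cell f h e (unit E) :=
  vpaste (CellChain.cons φ (CellChain.single ψ) he) (unitMul E) (Category.comp_id f)
    (Category.comp_id h)

/-- The identity 2-cell of a tight-cell, as a 2-cell into the loose-identity. -/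
noncomputable def unitOf {A E : X} (f : A ⟶ E) : Cell f f (LooseChain.nil A) (unit E) :=
  vpaste (CellChain.nil f) (unitCell E) (Category.comp_id f) (Category.comp_id f)

/-- Naturality of `unitComp` in its domain. Unit and associativity laws for general 2-cells follow
by substituting into the case of identity 2-cells. -/
theorem vpaste_unitComp {A B C A' B' C' E : X} {a : A ⟶ A'} {b : B ⟶ B'} {c : C ⟶ C'} {f : A' ⟶ E}
    {g : B' ⟶ E} {h : C' ⟶ E} {f' : A ⟶ E} {g' : B ⟶ E} {h' : C ⟶ E} {r : LooseChain A B}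
    {s : LooseChain B C} {t : LooseChain A C} {r' : LooseChain A' B'} {s' : LooseChain B' C'}
    {t' : LooseChain A' C'} (Γ : CellChain a b r r') (Δ : CellChain b c s s')
    (φ : Cell f g r' (unit E)) (ψ : Cell g h s' (unit E)) (ht' : r'.append s' = t')
    (ht : r.append s = t) (hf : a ≫ f = f') (hg : b ≫ g = g') (hh : c ≫ h = h') :
    vpaste (Γ.appendOfEq Δ ht ht') (unitComp φ ψ ht') hf hh =
      unitComp (vpaste Γ φ hf hg) (vpaste Δ ψ hg hh) ht :=
  vpaste_pair_vpaste _ _ _ _ _ _ _ _ _ _ _ _ _ _ _ _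

/-- A special case of the factorisation property of loose-identities. -/
theorem unitCell_cancel {D R S R' S' : X} (r : LooseChain R D) (s : LooseChain D S)
    {f : R ⟶ R'} {g : S ⟶ S'} {t : Loose S' R'}
    {φ ψ : Cell f g (r.append (LooseChain.cons (unit D) s)) t}
    (h : vpaste ((CellChain.ident r).append (CellChain.cons (unitCell D) (CellChain.ident s) rfl))
        φ (Category.id_comp f) (Category.id_comp g) =
      vpaste ((CellChain.ident r).append (CellChain.cons (unitCell D) (CellChain.ident s) rfl))
        ψ (Category.id_comp f) (Category.id_comp g)) : φ = ψ :=
  (unitCell_opcartesian D r s f g t _).unique h rfl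

theorem unitCell_vpaste_unitMul (E : X) :
    vpaste (CellChain.cons (unitCell E) (CellChain.ident (LooseChain.single (unit E))) rfl)
      (unitMul E) (Category.id_comp _) (Category.id_comp _) = idCell (unit E) :=
  (unitCell_opcartesian E (LooseChain.nil E) (LooseChain.single (unit E)) (𝟙 E) (𝟙 E) (unit E)
    (idCell (unit E))).choose_spec.1

theorem unitCell_vpaste_unitMap {D E : X} (u : D ⟶ E) :
    vpaste (CellChain.single (unitCell D)) (unitMap u) (Category.id_comp _) (Category.id_comp _) =
      unitOf u :=
  (unitCell_opcartesian D (LooseChain.nil D) (LooseChain.nil D) u u (unit E)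
    (vpaste (CellChain.nil u) (unitCell E) (Category.comp_id u) (Category.comp_id u))).choose_spec.1

/-- Left unit law for composition of 2-cells into a loose-identity. -/
theorem unitOf_unitComp {A B E : X} {f : A ⟶ E} {g : B ⟶ E} {c : LooseChain A B}
    (φ : Cell f g c (unit E)) : unitComp (unitOf f) φ rfl = φ := by
  -- View the composite as `f` and `φ` pasted onto `unitCell` and an identity: the lower part is
  -- then the equation that defines `unitMul`.
  have h := vpaste_pair_vpaste (CellChain.nil f) (unitCell E) (CellChain.single φ)
    (idCell (unit E)) (Category.comp_id f) (Category.comp_id f) (Category.comp_id g) rfl rfl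
    (unitMul E) (Category.comp_id f) (Category.comp_id g) (Category.id_comp _) (Category.id_comp _)
    (Category.comp_id f) (Category.comp_id g)
  rw [vpaste_id] at h
  refine h.symm.trans ?_
  have h' := unitCell_vpaste_unitMul E
  refine Eq.trans ?_ (vpaste_id φ)
  exact congrArg (fun θ => vpaste (CellChain.single φ) θ (Category.comp_id f) (Category.comp_id g))
    h'

/-- Only the left unit law is built into `unitMul`. The right one follows since both sides become
`unitOf (𝟙 E)` after `unitCell`, which is cancellable. -/
theorem unitComp_unitOf_idCell (E : X) :
    unitComp (idCell (unit E)) (unitOf (𝟙 E)) rfl = idCell (unit E) := by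
  apply unitCell_cancel (LooseChain.nil E) (LooseChain.nil E)
  have h := vpaste_unitComp (CellChain.single (unitCell E)) (CellChain.nil (𝟙 E)) (idCell (unit E))
    (unitOf (𝟙 E)) rfl rfl (Category.id_comp _) (Category.id_comp _) (Category.id_comp _)
  refine h.trans ?_
  have e₁ : vpaste (CellChain.single (unitCell E)) (idCell (unit E)) (Category.id_comp _)
    (Category.id_comp _) = unitOf (𝟙 E) := (vpaste_id _).trans (id_vpaste (unitCell E)).symm
  have e₂ : vpaste (CellChain.nil (𝟙 E)) (unitOf (𝟙 E)) (Category.id_comp _)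
    (Category.id_comp _) = unitOf (𝟙 E) := id_vpaste _
  rw [e₂, e₁, unitOf_unitComp]
  exact e₁.symm

/-- Right unit law for composition of 2-cells into a loose-identity. -/
theorem unitComp_unitOf {A B E : X} {f : A ⟶ E} {g : B ⟶ E} {c : LooseChain A B}
    (φ : Cell f g c (unit E)) : unitComp φ (unitOf g) c.append_nil = φ := by
  have h := vpaste_unitComp (CellChain.single φ) (CellChain.nil g) (idCell (unit E))
    (unitOf (𝟙 E)) rfl c.append_nil (Category.comp_id _) (Category.comp_id _) (Category.comp_id _)
  rw [unitComp_unitOf_idCell, vpaste_id] at h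
  have e₂ : vpaste (CellChain.nil g) (unitOf (𝟙 E)) (Category.comp_id _)
    (Category.comp_id _) = unitOf g := vpaste_nil_vpaste _ (Category.comp_id _) _ _ _ _ _ _
  rw [e₂] at h
  refine h.symm.trans ?_
  have e₃ : (CellChain.single φ).appendOfEq (CellChain.nil g) c.append_nil rfl =
    CellChain.single φ := CellChain.appendOfEq_nil _
  rw [e₃]
  exact vpaste_id φ

/-- Insert `unitCell` in the first of the three factors: by the left unit law both sides become
`unitMul E`. -/
theorem unitMul_assoc (E : X) :
    unitComp (unitMul E) (idCell (unit E)) rfl = unitComp (idCell (unit E)) (unitMul E) rfl := by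
  apply unitCell_cancel (LooseChain.nil E)
    (LooseChain.cons (unit E) (LooseChain.single (unit E)))
  have h := vpaste_unitComp (CellChain.cons (unitCell E)
    (CellChain.ident (LooseChain.single (unit E))) rfl) (CellChain.single (idCell (unit E)))
    (unitMul E) (idCell (unit E)) rfl rfl (Category.id_comp _) (Category.id_comp _)
    (Category.id_comp _)
  rw [unitCell_vpaste_unitMul, vpaste_id] at h
  have h' := vpaste_unitComp (CellChain.single (unitCell E)) (CellChain.ident
    (LooseChain.cons (unit E) (LooseChain.single (unit E)))) (idCell (unit E)) (unitMul E)
    rfl rfl (Category.id_comp _) (Category.id_comp _) (Category.id_comp _)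
  have e₁ : vpaste (CellChain.single (unitCell E)) (idCell (unit E)) (Category.id_comp _)
    (Category.id_comp _) = unitOf (𝟙 E) := (vpaste_id _).trans (id_vpaste (unitCell E)).symm
  rw [e₁, id_vpaste, unitOf_unitComp] at h'
  exact h.trans ((id_vpaste (unitMul E)).trans h'.symm)

/-- Composition of 2-cells into a loose-identity is associative. -/
theorem unitComp_assoc {A B C D E : X} {f : A ⟶ E} {g : B ⟶ E} {h : C ⟶ E} {k : D ⟶ E}
    {c : LooseChain A B} {d : LooseChain B C} {e : LooseChain C D} {cd : LooseChain A C}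
    {de : LooseChain B D} {cde : LooseChain A D} (φ : Cell f g c (unit E))
    (ψ : Cell g h d (unit E)) (χ : Cell h k e (unit E)) (hcd : c.append d = cd)
    (hde : d.append e = de) (h₁ : cd.append e = cde) (h₂ : c.append de = cde) :
    unitComp (unitComp φ ψ hcd) χ h₁ = unitComp φ (unitComp ψ χ hde) h₂ := by
  have H := vpaste_unitComp (CellChain.cons φ (CellChain.single ψ) hcd) (CellChain.single χ)
    (unitMul E) (idCell (unit E)) rfl h₁ (Category.comp_id _) (Category.comp_id _)
    (Category.comp_id _)
  have H' := vpaste_unitComp (CellChain.single φ) (CellChain.cons ψ (CellChain.single χ) hde)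
    (idCell (unit E)) (unitMul E) rfl h₂ (Category.comp_id _) (Category.comp_id _)
    (Category.comp_id _)
  rw [vpaste_id] at H H'
  refine H.symm.trans (Eq.trans ?_ H')
  rw [unitMul_assoc]
  -- It remains to identify the two bracketings of the chain `φ, ψ, χ`.
  subst hcd hde h₁
  congr 1
  have := CellChain.cons_appendOfEq φ (CellChain.nil g) c.append_nil
    (CellChain.cons ψ (CellChain.single χ) rfl) h₂ rfl rfl h₂
  refine Eq.trans ?_ this.symm
  exact CellChain.cons_appendOfEq φ (CellChain.single ψ) rfl (CellChain.single χ) rfl rfl rfl h₂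

end Equipment
end FormalCat

/-! ### 2-cells into `E(f, g)` computed in the loose-identity -/

namespace FormalCat

open LooseData CellData PastingData VirtualDoubleCategory VirtualEquipment

noncomputable section Equipment

variable {X : Type u} [VirtualEquipment.{v, w, z} X]

/-- The composite of a 2-cell into `E(f, g)` with the cartesian 2-cell `E(f, g) ⇒ E(1, 1)`. -/
def toUnit {R S A B E : X} {f : A ⟶ E} {g : B ⟶ E} {h : R ⟶ A} {k : S ⟶ B} {f₁ : R ⟶ E}
    {g₁ : S ⟶ E} {c : LooseChain R S} (φ : Cell h k c (hom f g)) (hf : h ≫ f = f₁)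
    (hg : k ≫ g = g₁) : Cell f₁ g₁ c (unit E) :=
  vpaste (CellChain.single φ) (homCell f g) hf hg

/-- This is cartesianness of `homCell`. Together with `toUnit_homLift` it makes `toUnit` a bijection
with inverse `homLift`, so equations in `E(f, g)` can be tested in `E(1, 1)`. -/
theorem toUnit_injective {R S A B E : X} {f : A ⟶ E} {g : B ⟶ E} {h : R ⟶ A} {k : S ⟶ B}
    {f₁ : R ⟶ E} {g₁ : S ⟶ E} {c : LooseChain R S} {φ ψ : Cell h k c (hom f g)}
    (hf : h ≫ f = f₁) (hg : k ≫ g = g₁) (H : toUnit φ hf hg = toUnit ψ hf hg) : φ = ψ := by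
  subst hf hg
  exact (restrCell_cartesian (unit E) f g h k c _).unique H rfl

theorem toUnit_homLift {R S A B E : X} {f : A ⟶ E} {g : B ⟶ E} {h : R ⟶ A} {k : S ⟶ B} {f₁ : R ⟶ E}
    {g₁ : S ⟶ E} {c : LooseChain R S} (φ : Cell f₁ g₁ c (unit E)) (hf : h ≫ f = f₁)
    (hg : k ≫ g = g₁) : toUnit (homLift φ hf hg) hf hg = φ := by
  subst hf hg
  exact (restrCell_cartesian (unit E) f g h k c _).choose_spec.1.trans (id_vpaste φ)

theorem vpaste_toUnit {R S R' S' A B E : X} {f : A ⟶ E} {g : B ⟶ E} {h : R ⟶ A} {k : S ⟶ B}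
    {f₁ : R ⟶ E} {g₁ : S ⟶ E} {c : LooseChain R S} {a : R' ⟶ R} {b : S' ⟶ S} {h' : R' ⟶ A}
    {k' : S' ⟶ B} {f₂ : R' ⟶ E} {g₂ : S' ⟶ E} {d : LooseChain R' S'} (Γ : CellChain a b d c)
    (φ : Cell h k c (hom f g)) (hf : h ≫ f = f₁) (hg : k ≫ g = g₁) (hf₂ : a ≫ f₁ = f₂)
    (hg₂ : b ≫ g₁ = g₂) (ha : a ≫ h = h') (hb : b ≫ k = k') (hf' : h' ≫ f = f₂)
    (hg' : k' ≫ g = g₂) :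
    vpaste Γ (toUnit φ hf hg) hf₂ hg₂ = toUnit (vpaste Γ φ ha hb) hf' hg' :=
  vpaste_single_vpaste _ _ _ _ _ _ _ _ _ _ _

theorem toUnit_idCell {A B E : X} (f : A ⟶ E) (g : B ⟶ E) :
    toUnit (idCell (hom f g)) (Category.id_comp f) (Category.id_comp g) = homCell f g :=
  vpaste_single_idCell _

theorem toUnit_paste {A B C E : X} {f : A ⟶ E} {g : B ⟶ E} {h : C ⟶ E} {c : LooseChain A B}
    {d : LooseChain B C} (φ : Cell (𝟙 A) (𝟙 B) c (hom f g))
    (ψ : Cell (𝟙 B) (𝟙 C) d (hom g h)) :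
    toUnit (paste φ ψ) (Category.id_comp f) (Category.id_comp h) =
      unitComp (toUnit φ (Category.id_comp f) (Category.id_comp g))
        (toUnit ψ (Category.id_comp g) (Category.id_comp h)) rfl := by
  have h₁ := vpaste_toUnit (CellChain.cons φ (CellChain.single ψ) rfl) (homComp f g h)
    (Category.id_comp f) (Category.id_comp h) (Category.id_comp f) (Category.id_comp h)
    (Category.id_comp _) (Category.id_comp _) (Category.id_comp f) (Category.id_comp h)
  refine h₁.symm.trans ?_
  have h₂ := vpaste_unitComp (CellChain.single φ) (CellChain.single ψ) (homCell f g) (homCell g h)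
    rfl rfl (Category.id_comp f) (Category.id_comp g) (Category.id_comp h)
  refine Eq.trans ?_ h₂
  unfold homComp
  rw [toUnit_homLift]
  rfl

theorem toUnit_vcomp {A D E : X} {f : A ⟶ E} {g : D ⟶ E} {c : LooseChain A D} {p : Loose D A}
    (φ : Cell (𝟙 A) (𝟙 D) c p) (α : Cell (𝟙 A) (𝟙 D) (LooseChain.single p) (hom f g)) :
    toUnit (vcomp φ α) (Category.id_comp f) (Category.id_comp g) =
      vpaste (CellChain.single φ) (toUnit α (Category.id_comp f) (Category.id_comp g))
        (Category.id_comp f) (Category.id_comp g) :=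
  (vpaste_toUnit _ _ _ _ _ _ _ _ _ _).symm

theorem toUnit_whisker {A B D E : X} (u : D ⟶ E) {a : A ⟶ D} {b : B ⟶ D} {a' : A ⟶ E} {b' : B ⟶ E}
    (ha : a ≫ u = a') (hb : b ≫ u = b') {c : LooseChain A B}
    (φ : Cell (𝟙 A) (𝟙 B) c (hom a b)) :
    toUnit (whisker u ha hb φ) (Category.id_comp a') (Category.id_comp b') =
      vpaste (CellChain.single (toUnit φ (Category.id_comp a) (Category.id_comp b)))
        (unitMap u) ha hb := by
  have h₁ := vpaste_toUnit (CellChain.single φ) (homMap u ha hb)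
    (Category.id_comp a') (Category.id_comp b') (Category.id_comp a') (Category.id_comp b')
    (Category.id_comp _) (Category.id_comp _) (Category.id_comp a') (Category.id_comp b')
  refine h₁.symm.trans ?_
  unfold homMap
  rw [toUnit_homLift]
  exact vpaste_single_vpaste _ _ _ _ _ _ _ _ _ _ _

/-- The action of a tight-cell on loose-identities preserves composition. -/
theorem unitMul_vpaste_unitMap {D E : X} (u : D ⟶ E) :
    vpaste (CellChain.single (unitMul D)) (unitMap u) (Category.id_comp u) (Category.id_comp u) =
      unitComp (unitMap u) (unitMap u) (LooseChain.single_append _ _) := by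
  -- After the unit is inserted in the first factor, both sides reduce to `unitMap u`.
  apply unitCell_cancel (LooseChain.nil D) (LooseChain.single (unit D))
  have h := vpaste_unitComp (CellChain.single (unitCell D)) (CellChain.ident
    (LooseChain.single (unit D))) (unitMap u) (unitMap u) rfl rfl (Category.id_comp u)
    (Category.id_comp u) (Category.id_comp u)
  rw [unitCell_vpaste_unitMap, id_vpaste, unitOf_unitComp] at h
  have h' := vpaste_single_vpaste (CellChain.cons (unitCell D)
    (CellChain.ident (LooseChain.single (unit D))) rfl) (unitMul D) (unitMap u)
    (Category.id_comp _) (Category.id_comp _) (Category.id_comp u) (Category.id_comp u)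
    (Category.id_comp u) (Category.id_comp u) (Category.id_comp u) (Category.id_comp u)
  rw [unitCell_vpaste_unitMul] at h'
  exact h'.trans ((vpaste_single_idCell (unitMap u)).trans h.symm)

/-- The right action of a loose-identity on a loose-cell. -/
def rightUnitor {A D : X} (p : Loose D A) :
    Cell (𝟙 A) (𝟙 D) (LooseChain.cons p (LooseChain.single (unit D))) p :=
  (unitCell_opcartesian D (LooseChain.single p) (LooseChain.nil D) (𝟙 A) (𝟙 D) p
    (idCell p)).choose

theorem unitCell_vpaste_rightUnitor {A D : X} (p : Loose D A) :
    vpaste (CellChain.cons (idCell p) (CellChain.single (unitCell D)) rfl) (rightUnitor p)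
      (Category.id_comp _) (Category.id_comp _) = idCell p :=
  (unitCell_opcartesian D (LooseChain.single p) (LooseChain.nil D) (𝟙 A) (𝟙 D) p
    (idCell p)).choose_spec.1

/-- Every 2-cell into a loose-identity is compatible with the actions of loose-identities on the
right. -/
theorem rightUnitor_vpaste {A D E : X} {p : Loose D A} {h : A ⟶ E} {u : D ⟶ E}
    (θ : Cell h u (LooseChain.single p) (unit E)) :
    vpaste (CellChain.single (rightUnitor p)) θ (Category.id_comp h) (Category.id_comp u) =
      unitComp θ (unitMap u) (LooseChain.single_append _ _) := by
  -- After the unit is inserted in `D(1, 1)`, both sides reduce to `θ`.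
  apply unitCell_cancel (LooseChain.single p) (LooseChain.nil D)
  have e := vpaste_unitComp (CellChain.single (idCell p)) (CellChain.single (unitCell D)) θ (unitMap u)
    rfl rfl (Category.id_comp h) (Category.id_comp u) (Category.id_comp u)
  rw [unitCell_vpaste_unitMap, vpaste_single_idCell] at e
  have e' := vpaste_single_vpaste (CellChain.cons (idCell p) (CellChain.single (unitCell D)) rfl)
    (rightUnitor p) θ (Category.id_comp _) (Category.id_comp _) (Category.id_comp h)
    (Category.id_comp u) (Category.id_comp h) (Category.id_comp u) (Category.id_comp h)
    (Category.id_comp u)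
  rw [unitCell_vpaste_rightUnitor] at e'
  refine e'.trans ((vpaste_single_idCell θ).trans ?_)
  exact ((unitComp_unitOf θ).symm.trans e.symm)

/-- The cartesian 2-cell `E(j, e) ⇒ E(j, u)` for `e = x ≫ u`. -/
def homRestr {A D D' E : X} (j : A ⟶ E) {u : D ⟶ E} {x : D' ⟶ D} {e : D' ⟶ E} (hx : x ≫ u = e) :
    Cell (𝟙 A) x (LooseChain.single (hom j e)) (hom j u) :=
  homLift (homCell j e) (Category.id_comp j) hx

theorem toUnit_restrExt {A D D' E : X} {j t : A ⟶ E} {u : D ⟶ E}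
    (α : Cell (𝟙 A) (𝟙 D) (LooseChain.single (hom j u)) (hom t u))
    {x : D' ⟶ D} {e : D' ⟶ E} (hx : x ≫ u = e) :
    toUnit (restrExt α hx) (Category.id_comp t) (Category.id_comp e) =
      vpaste (CellChain.single (homRestr j hx))
        (toUnit α (Category.id_comp t) (Category.id_comp u)) (Category.id_comp t) hx := by
  unfold restrExt
  rw [toUnit_homLift]
  exact (vpaste_toUnit _ _ _ _ _ _ _ _ _ _).symm

/-- Composition with a restricted 2-cell. -/
theorem toUnit_vcomp_restrExt {A D D' E : X} {j t : A ⟶ E} {u : D ⟶ E}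
    (α : Cell (𝟙 A) (𝟙 D) (LooseChain.single (hom j u)) (hom t u))
    {x : D' ⟶ D} {e : D' ⟶ E} (hx : x ≫ u = e) {c : LooseChain A D'}
    (φ : Cell (𝟙 A) (𝟙 D') c (hom j e)) :
    toUnit (vcomp φ (restrExt α hx)) (Category.id_comp t) (Category.id_comp e) =
      vpaste (CellChain.single (homLift (toUnit φ (Category.id_comp j) (Category.id_comp e))
        (Category.id_comp j) hx : Cell (𝟙 A) x c (hom j u)))
        (toUnit α (Category.id_comp t) (Category.id_comp u)) (Category.id_comp t) hx := by
  rw [toUnit_vcomp, toUnit_restrExt]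
  have h := vpaste_single_vpaste (CellChain.single φ) (homRestr j hx)
    (toUnit α (Category.id_comp t) (Category.id_comp u)) (Category.id_comp _) (Category.id_comp _)
    (Category.id_comp t) hx (Category.id_comp t) hx (Category.id_comp t) (Category.id_comp e)
  refine h.trans ?_
  congr 2
  apply toUnit_injective (Category.id_comp j) hx
  rw [toUnit_homLift]
  have h' := vpaste_toUnit (CellChain.single φ) (homRestr j hx) (Category.id_comp j) hx
    (Category.id_comp j) (Category.id_comp e) (Category.id_comp _) (Category.id_comp _)
    (Category.id_comp j) hx
  refine h'.symm.trans ?_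
  unfold homRestr
  rw [toUnit_homLift]
  rfl

end Equipment
end FormalCat

/-! ### Laws of pasting and naturality of restricted extension operators -/

namespace FormalCat

open LooseData CellData PastingData VirtualDoubleCategory VirtualEquipment

noncomputable section Equipment

variable {X : Type u} [VirtualEquipment.{v, w, z} X]

theorem vpaste_pair_unitComp {A B C A' B' C' E : X} {a : A ⟶ A'} {b : B ⟶ B'} {c : C ⟶ C'} {f : A' ⟶ E}
    {g : B' ⟶ E} {h : C' ⟶ E} {f' : A ⟶ E} {g' : B ⟶ E} {h' : C ⟶ E} {r : LooseChain A B}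
    {s : LooseChain B C} {t : LooseChain A C} {p : Loose B' A'} {q : Loose C' B'}
    (φ : Cell a b r p) (ψ : Cell b c s q) (θ : Cell f g (LooseChain.single p) (unit E))
    (χ : Cell g h (LooseChain.single q) (unit E)) (ht : r.append s = t) (hf : a ≫ f = f')
    (hg : b ≫ g = g') (hh : c ≫ h = h') :
    vpaste (CellChain.cons φ (CellChain.single ψ) ht)
      (unitComp θ χ (LooseChain.single_append p (LooseChain.single q))) hf hh =
      unitComp (vpaste (CellChain.single φ) θ hf hg) (vpaste (CellChain.single ψ) χ hg hh) ht := by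
  subst ht
  exact vpaste_unitComp (CellChain.single φ) (CellChain.single ψ) θ χ rfl rfl hf hg hh

theorem vpaste_paste {A B C E : X} {f : A ⟶ E} {g : B ⟶ E} {h : C ⟶ E}
    {c : LooseChain A B} {d : LooseChain B C} {r : LooseChain A B} {s : LooseChain B C}
    (Γ : CellChain (𝟙 A) (𝟙 B) r c) (Δ : CellChain (𝟙 B) (𝟙 C) s d)
    (φ : Cell (𝟙 A) (𝟙 B) c (hom f g)) (ψ : Cell (𝟙 B) (𝟙 C) d (hom g h)) :
    vpaste (Γ.append Δ) (paste φ ψ) (Category.id_comp _) (Category.id_comp _) =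
      paste (vpaste Γ φ (Category.id_comp _) (Category.id_comp _))
        (vpaste Δ ψ (Category.id_comp _) (Category.id_comp _)) :=
  vpaste_pair_vpaste Γ φ Δ ψ (Category.id_comp _) (Category.id_comp _) (Category.id_comp _) rfl rfl
    (homComp f g h) _ _ _ _ _ _

theorem vpaste_vcomp {A B : X} {c d : LooseChain A B} {p q : Loose B A}
    (Γ : CellChain (𝟙 A) (𝟙 B) d c) (φ : Cell (𝟙 A) (𝟙 B) c p)
    (ψ : Cell (𝟙 A) (𝟙 B) (LooseChain.single p) q) :
    vpaste Γ (vcomp φ ψ) (Category.id_comp _) (Category.id_comp _) =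
      vcomp (vpaste Γ φ (Category.id_comp _) (Category.id_comp _)) ψ :=
  vpaste_single_vpaste _ _ _ _ _ _ _ _ _ _ _

theorem vcomp_idCell {A B : X} {c : LooseChain A B} {p : Loose B A} (φ : Cell (𝟙 A) (𝟙 B) c p) :
    vcomp φ (idCell p) = φ :=
  vpaste_id φ

theorem hom_ext {A B E : X} {f : A ⟶ E} {g : B ⟶ E} {c : LooseChain A B}
    {φ ψ : Cell (𝟙 A) (𝟙 B) c (hom f g)}
    (h : toUnit φ (Category.id_comp f) (Category.id_comp g) =
      toUnit ψ (Category.id_comp f) (Category.id_comp g)) : φ = ψ :=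
  toUnit_injective _ _ h

/-- Pasting is associative; the first chain is assumed to have length one so that both sides
have the same type. -/
theorem single_paste_assoc {A B C D E : X} {f : A ⟶ E} {g : B ⟶ E} {h : C ⟶ E} {k : D ⟶ E}
    {p : Loose B A} {d : LooseChain B C} {e : LooseChain C D}
    (φ : Cell (𝟙 A) (𝟙 B) (LooseChain.single p) (hom f g))
    (ψ : Cell (𝟙 B) (𝟙 C) d (hom g h)) (χ : Cell (𝟙 C) (𝟙 D) e (hom h k)) :
    (paste (paste φ ψ) χ : Cell (𝟙 A) (𝟙 D) (LooseChain.cons p (d.append e)) (hom f k)) =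
      paste φ (paste ψ χ) := by
  apply hom_ext
  have h₁ := toUnit_paste (paste φ ψ) χ
  have h₂ := toUnit_paste φ (paste ψ χ)
  rw [toUnit_paste φ ψ] at h₁
  rw [toUnit_paste ψ χ] at h₂
  exact h₁.trans ((unitComp_assoc _ _ _ _ _ _ _).trans h₂.symm)

theorem nil_paste_assoc {A C D E : X} {f : A ⟶ E} {g : A ⟶ E} {h : C ⟶ E} {k : D ⟶ E}
    {d : LooseChain A C} {e : LooseChain C D}
    (φ : Cell (𝟙 A) (𝟙 A) (LooseChain.nil A) (hom f g))
    (ψ : Cell (𝟙 A) (𝟙 C) d (hom g h)) (χ : Cell (𝟙 C) (𝟙 D) e (hom h k)) :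
    (paste (paste φ ψ) χ : Cell (𝟙 A) (𝟙 D) (d.append e) (hom f k)) =
      paste φ (paste ψ χ) := by
  apply hom_ext
  have h₁ := toUnit_paste (paste φ ψ) χ
  have h₂ := toUnit_paste φ (paste ψ χ)
  rw [toUnit_paste φ ψ] at h₁
  rw [toUnit_paste ψ χ] at h₂
  exact h₁.trans ((unitComp_assoc _ _ _ _ _ _ _).trans h₂.symm)

/-- Functoriality of `u` on graded 2-cells; in `E(1, 1)` it is the compatibility of `unitMap u` with
`unitMul`. -/
theorem whisker_paste {A B C D E : X} (u : D ⟶ E) {a : A ⟶ D} {b : B ⟶ D} {c : C ⟶ D}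
    {a' : A ⟶ E} {b' : B ⟶ E} {c' : C ⟶ E} (ha : a ≫ u = a') (hb : b ≫ u = b')
    (hc : c ≫ u = c') {r : LooseChain A B} {s : LooseChain B C}
    (φ : Cell (𝟙 A) (𝟙 B) r (hom a b)) (ψ : Cell (𝟙 B) (𝟙 C) s (hom b c)) :
    whisker u ha hc (paste φ ψ) = paste (whisker u ha hb φ) (whisker u hb hc ψ) := by
  apply hom_ext
  rw [toUnit_whisker, toUnit_paste, toUnit_paste, toUnit_whisker, toUnit_whisker]
  rw [← vpaste_pair_unitComp _ _ (unitMap u) (unitMap u) rfl ha hb hc, ← unitMul_vpaste_unitMap]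
  exact (vpaste_single_vpaste _ _ _ _ _ _ _ _ _ _ _).symm

/-- Restrictions of a 2-cell `E(j, u) ⇒ E(t, u)` are natural with respect to the 2-cells that are
obtained by postcomposition with `u`. -/
theorem vcomp_paste_whisker_restrExt {A C C' D E : X} {j t : A ⟶ E} {u : D ⟶ E}
    (α : Cell (𝟙 A) (𝟙 D) (LooseChain.single (hom j u)) (hom t u)) {x : C ⟶ D} {x' : C' ⟶ D}
    {e : C ⟶ E} {e' : C' ⟶ E} (hx : x ≫ u = e) (hx' : x' ≫ u = e') {c : LooseChain C C'}
    (ψ : Cell (𝟙 C) (𝟙 C') c (hom x x')) :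
    vcomp (paste (idCell (hom j e)) (whisker u hx hx' ψ)) (restrExt α hx') =
      paste (restrExt α hx) (whisker u hx hx' ψ) := by
  apply hom_ext
  rw [toUnit_vcomp_restrExt, toUnit_paste, toUnit_paste, toUnit_whisker, toUnit_idCell,
    toUnit_restrExt]
  set ψ' := toUnit ψ (Category.id_comp x) (Category.id_comp x')
  -- The 2-cell fed to `α` is `homRestr` and `ψ'` pasted onto the right action of `D(1, 1)` on `E(j,
  -- u)`. By `rightUnitor_vpaste` this action passes through `α`, which is the whole content of
  -- naturality.
  have key : (homLift (unitComp (homCell j e) (vpaste (CellChain.single ψ') (unitMap u) hx hx') rfl)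
      (Category.id_comp j) hx' : Cell (𝟙 A) x' _ (hom j u)) =
      vpaste (CellChain.cons (homRestr j hx) (CellChain.single ψ') rfl) (rightUnitor (hom j u))
        (Category.id_comp _) (Category.comp_id _) := by
    apply toUnit_injective (Category.id_comp j) hx'
    rw [toUnit_homLift]
    have h₁ := vpaste_pair_unitComp (homRestr j hx) ψ' (homCell j u) (unitMap u) rfl
      (Category.id_comp j) hx hx'
    rw [← rightUnitor_vpaste] at h₁
    have h₂ : vpaste (CellChain.single (homRestr j hx)) (homCell j u) (Category.id_comp j) hx =
      homCell j e := toUnit_homLift _ _ _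
    rw [h₂] at h₁
    exact h₁.symm.trans (vpaste_single_vpaste _ _ _ _ _ _ _ _ _ _ _)
  rw [key, ← vpaste_pair_unitComp (homRestr j hx) ψ' _ (unitMap u) rfl (Category.id_comp t) hx hx',
    ← rightUnitor_vpaste]
  exact (vpaste_single_vpaste _ _ _ _ _ _ _ _ _ _ _).symm

/-! ### Restriction of algebras along tight-cells -/

namespace RelativeMonad.Algebra

variable {A E : X} {j : A ⟶ E} {T : RelativeMonad j}

/-- The restriction of an algebra along a tight-cell. -/
def restrict {D D' : X} (U : T.Algebra D) (x : D' ⟶ D) : T.Algebra D' where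
  carrier := x ≫ U.carrier
  ext := restrExt U.ext rfl
  unit_law := by
    apply hom_ext
    have h := toUnit_paste T.unit (restrExt U.ext (rfl : x ≫ U.carrier = x ≫ U.carrier))
    refine h.trans ?_
    rw [toUnit_restrExt]
    refine Eq.trans ?_ (toUnit_idCell j (x ≫ U.carrier)).symm
    -- The left side is the unit law of `U` with `homRestr` pasted on top.
    have h₁ := vpaste_unitComp (CellChain.nil (𝟙 A)) (CellChain.single (homRestr j
      (rfl : x ≫ U.carrier = x ≫ U.carrier))) (toUnit T.unit (Category.id_comp j)
        (Category.id_comp T.carrier)) (toUnit U.ext (Category.id_comp T.carrier)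
        (Category.id_comp U.carrier)) rfl rfl (Category.id_comp j) (Category.id_comp T.carrier) rfl
    have h₂ := toUnit_paste T.unit U.ext
    rw [← h₂] at h₁
    have h₃ : vpaste (CellChain.nil (𝟙 A)) (toUnit T.unit (Category.id_comp j)
      (Category.id_comp T.carrier)) (Category.id_comp j) (Category.id_comp T.carrier) =
      toUnit T.unit (Category.id_comp j) (Category.id_comp T.carrier) := id_vpaste _
    rw [h₃] at h₁
    refine h₁.symm.trans ?_
    have h₄ := congrArg (fun θ => toUnit θ (Category.id_comp j) (Category.id_comp U.carrier))
      U.unit_law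
    refine Eq.trans (congrArg (fun θ => vpaste (CellChain.single (homRestr j
      (rfl : x ≫ U.carrier = x ≫ U.carrier))) θ (Category.id_comp j) rfl)
      (h₄.trans (toUnit_idCell _ _))) ?_
    exact toUnit_homLift _ _ _
  ext_law := by
    apply hom_ext
    rw [toUnit_vcomp_restrExt, toUnit_paste, toUnit_paste, toUnit_idCell, toUnit_restrExt]
    have hx : x ≫ U.carrier = x ≫ U.carrier := rfl
    -- The input of the outer extension operator is that of `U` with an identity and `homRestr`
    -- pasted on top. Both sides are thus the two sides of `U.ext_law` under the same chain.
    have key : (homLift (unitComp (homCell j T.carrier) (vpaste (CellChain.single (homRestr j hx))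
        (toUnit U.ext (Category.id_comp _) (Category.id_comp _)) (Category.id_comp _) hx) rfl)
        (Category.id_comp j) hx : Cell (𝟙 A) x _ (hom j U.carrier)) =
        vpaste (CellChain.cons (idCell (hom j T.carrier)) (CellChain.single (homRestr j hx)) rfl)
          (paste (idCell (hom j T.carrier)) U.ext) (Category.id_comp _) (Category.comp_id _) := by
      apply toUnit_injective (Category.id_comp j) hx
      rw [toUnit_homLift]
      have h₁ := vpaste_pair_unitComp (idCell (hom j T.carrier)) (homRestr j hx)
        (homCell j T.carrier) (toUnit U.ext (Category.id_comp _) (Category.id_comp _)) rfl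
        (Category.id_comp j) (Category.id_comp _) hx
      rw [vpaste_single_idCell] at h₁
      have h₂ := toUnit_paste (idCell (hom j T.carrier)) U.ext
      rw [toUnit_idCell] at h₂
      refine h₁.symm.trans ?_
      refine Eq.trans (congrArg (fun θ => vpaste (CellChain.cons (idCell (hom j T.carrier))
        (CellChain.single (homRestr j hx)) rfl) θ (Category.id_comp j) hx) h₂.symm) ?_
      exact vpaste_toUnit _ _ _ _ _ _ _ _ _ _
    rw [key]
    have h₁ := vpaste_pair_unitComp (idCell (hom j T.carrier)) (homRestr j hx)
        (toUnit T.ext (Category.id_comp _) (Category.id_comp _))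
        (toUnit U.ext (Category.id_comp _) (Category.id_comp _)) rfl
        (Category.id_comp _) (Category.id_comp _) hx
    rw [vpaste_single_idCell] at h₁
    refine Eq.trans ?_ h₁
    refine (vpaste_single_vpaste _ _ _ _ _ _ _ (Category.id_comp _) (Category.id_comp _)
      (Category.id_comp _) hx).symm.trans ?_
    have h₂ := toUnit_vcomp (paste (idCell (hom j T.carrier)) U.ext) U.ext
    refine congrArg (fun θ => vpaste (CellChain.cons (idCell (hom j T.carrier))
        (CellChain.single (homRestr j hx)) rfl) θ (Category.id_comp _) hx) ?_
    rw [U.ext_law] at h₂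
    exact h₂.symm.trans (toUnit_paste _ _)

end RelativeMonad.Algebra

end Equipment
end FormalCat

/-! ### Companions and the universal property of colimits -/

namespace FormalCat

open LooseData CellData PastingData VirtualDoubleCategory VirtualEquipment

noncomputable section Equipment

variable {X : Type u} [VirtualEquipment.{v, w, z} X]

/-- This makes the generic algebra the one classified by the identity tight-cell, so that 2-cells
into `Alg(T)(x, 1)` fall under the universal property of the algebra object. -/
theorem restrExt_id {A D E : X} {j t : A ⟶ E} {u : D ⟶ E}
    (α : Cell (𝟙 A) (𝟙 D) (LooseChain.single (hom j u)) (hom t u)) :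
    restrExt α (Category.id_comp u) = α := by
  apply hom_ext
  rw [toUnit_restrExt]
  have h : homRestr j (Category.id_comp u) = idCell (hom j u) :=
    hom_ext ((toUnit_homLift _ _ _).trans (toUnit_idCell j u).symm)
  rw [h]
  exact vpaste_single_idCell _

/-- The unit `⇒ E(u, 1)` of the companion of a tight-cell `u : D ⟶ E`. -/
def companionUnit {D E : X} (u : D ⟶ E) : Cell (𝟙 D) u (LooseChain.nil D) (hom u (𝟙 E)) :=
  homLift (unitOf u) (Category.id_comp u) (Category.comp_id u)

/-- Transposition of a 2-cell `s, E(u, 1) ⇒ E(w, 1)` to a 2-cell `s ⇒ E(w, u)`. -/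
def companionTranspose {Y D E : X} {w : Y ⟶ E} (u : D ⟶ E) {s : LooseChain Y D}
    (χ : Cell (𝟙 Y) (𝟙 E) (s.append (LooseChain.single (hom u (𝟙 E)))) (hom w (𝟙 E))) :
    Cell (𝟙 Y) (𝟙 D) s (hom w u) :=
  homLift (vpaste ((CellChain.ident s).appendOfEq (CellChain.single (companionUnit u))
    s.append_nil rfl) (toUnit χ (Category.id_comp w) (Category.id_comp (𝟙 E)))
    (Category.id_comp w) (Category.comp_id u)) (Category.id_comp w) (Category.id_comp u)

/-- A triangle identity for the companion of `u`. Only this half of the transposition bijection is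
needed. -/
theorem companionTranspose_paste_idCell {Y D E : X} {w : Y ⟶ E} (u : D ⟶ E) {s : LooseChain Y D}
    (ψ : Cell (𝟙 Y) (𝟙 D) s (hom w u)) :
    companionTranspose u (paste ψ (idCell (hom u (𝟙 E)))) = ψ := by
  apply hom_ext
  unfold companionTranspose
  rw [toUnit_homLift, toUnit_paste, toUnit_idCell,
    vpaste_unitComp _ _ _ _ _ _ (Category.id_comp w) (Category.id_comp u) (Category.comp_id u), id_vpaste]
  have h : vpaste (CellChain.single (companionUnit u)) (homCell u (𝟙 E)) (Category.id_comp u)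
    (Category.comp_id u) = unitOf u := toUnit_homLift _ _ _
  rw [h, unitComp_unitOf]

/-- Transposition acts at the right end of the chain and pasting with `φ` at the left end, so they
commute. -/
theorem companionTranspose_paste {Y Z D E : X} {p : Loose Y Z} {f : Z ⟶ E} {w : Y ⟶ E} (u : D ⟶ E)
    {s : LooseChain Y D} (φ : Cell (𝟙 Z) (𝟙 Y) (LooseChain.single p) (hom f w))
    (χ : Cell (𝟙 Y) (𝟙 E) (s.append (LooseChain.single (hom u (𝟙 E)))) (hom w (𝟙 E))) :
    companionTranspose (s := LooseChain.cons p s) u (paste φ χ : Cell (𝟙 Z) (𝟙 E)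
      (LooseChain.cons p (s.append (LooseChain.single (hom u (𝟙 E))))) (hom f (𝟙 E))) =
      paste φ (companionTranspose u χ) := by
  apply hom_ext
  unfold companionTranspose
  have h := toUnit_paste φ (companionTranspose u χ)
  unfold companionTranspose at h
  rw [toUnit_homLift] at h
  rw [toUnit_homLift]
  refine Eq.trans ?_ h.symm
  have h₂ := vpaste_unitComp (CellChain.single (idCell p))
    ((CellChain.ident s).appendOfEq (CellChain.single (companionUnit u)) s.append_nil rfl)
    (toUnit φ (Category.id_comp f) (Category.id_comp w))
    (toUnit χ (Category.id_comp w) (Category.id_comp (𝟙 E))) rfl rfl (Category.id_comp f)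
    (Category.id_comp w) (Category.comp_id u)
  rw [vpaste_single_idCell] at h₂
  refine Eq.trans ?_ h₂
  have h₃ := CellChain.cons_appendOfEq (idCell p) (CellChain.ident s) rfl
    (CellChain.single (companionUnit u)) (LooseChain.append_nil (LooseChain.cons p s)) rfl
    s.append_nil rfl
  have h₄ := toUnit_paste φ χ
  refine (congrArg (fun Γ => vpaste Γ _ (Category.id_comp f) (Category.comp_id u)) h₃).trans ?_
  exact congrArg (fun θ => vpaste _ θ (Category.id_comp f) (Category.comp_id u)) h₄

/-- The universal property of a weighted colimit extends to 2-cells into `E(w, u)`, for an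
arbitrary tight-cell `u`. -/
theorem Cocone.IsColimit.bijective {Y Z D E : X} {p : Loose Y Z} {f : Z ⟶ E} {k : Cocone p f}
    (hk : k.IsColimit) (u : D ⟶ E) (q : LooseChain Y D) :
    Function.Bijective (fun ψ : Cell (𝟙 Y) (𝟙 D) q (hom k.pt u) =>
      (paste k.cell ψ : Cell (𝟙 Z) (𝟙 D) (LooseChain.cons p q) (hom f u))) := by
  -- The given universal property only concerns `E(w, 1)`; it is applied to the chain `q` lengthened
  -- by the companion `E(u, 1)`.
  have H := hk (q.append (LooseChain.single (hom u (𝟙 E))))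
  constructor
  · intro ψ₁ ψ₂ h
    have h' : paste ψ₁ (idCell (hom u (𝟙 E))) = paste ψ₂ (idCell (hom u (𝟙 E))) := by
      apply H.1
      refine (single_paste_assoc k.cell ψ₁ (idCell (hom u (𝟙 E)))).symm.trans
        (Eq.trans ?_ (single_paste_assoc k.cell ψ₂ (idCell (hom u (𝟙 E)))))
      exact congrArg (fun θ : Cell (𝟙 Z) (𝟙 D) (LooseChain.cons p q) (hom f u) =>
        paste θ (idCell (hom u (𝟙 E)))) h
    rw [← companionTranspose_paste_idCell u ψ₁, h', companionTranspose_paste_idCell]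
  · intro ε
    -- Factor `ε` pasted with the identity of `E(u, 1)`, then transpose the factorisation back.
    obtain ⟨χ, hχ⟩ := H.2 (paste (c := LooseChain.cons p q) ε (idCell (hom u (𝟙 E))))
    refine ⟨companionTranspose u χ, ?_⟩
    refine (companionTranspose_paste u k.cell χ).symm.trans (Eq.trans ?_
      (companionTranspose_paste_idCell u ε))
    exact congrArg (companionTranspose (s := LooseChain.cons p q) u) hχ

theorem vpaste_append_idCell_paste {A B C E : X} {f : A ⟶ E} {g : B ⟶ E} {h : C ⟶ E}
    {c : LooseChain A B} {d : LooseChain B C} (φ : Cell (𝟙 A) (𝟙 B) c (hom f g))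
    (ψ : Cell (𝟙 B) (𝟙 C) d (hom g h)) :
    vpaste ((CellChain.single φ).append (CellChain.ident d)) (paste (idCell (hom f g)) ψ)
      (Category.id_comp _) (Category.id_comp _) = paste φ ψ := by
  rw [vpaste_paste, id_vpaste]
  exact congrArg (fun θ => paste θ ψ) (vpaste_id φ)

/-- Compatibility with extension operators may be tested on generalised elements of `E(j, e)`. -/
theorem vcomp_paste_of_vcomp_paste_idCell {A C C' E : X} {j t : A ⟶ E} {e : C ⟶ E} {e' : C' ⟶ E}
    {α : Cell (𝟙 A) (𝟙 C) (LooseChain.single (hom j e)) (hom t e)}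
    {α' : Cell (𝟙 A) (𝟙 C') (LooseChain.single (hom j e')) (hom t e')} {p : LooseChain C C'}
    {ε : Cell (𝟙 C) (𝟙 C') p (hom e e')}
    (h : vcomp (paste (idCell (hom j e)) ε) α' = paste α ε) {c : LooseChain A C}
    (φ : Cell (𝟙 A) (𝟙 C) c (hom j e)) :
    vcomp (paste φ ε) α' = paste (vcomp φ α) ε := by
  rw [← vpaste_append_idCell_paste φ ε, ← vpaste_vcomp, h, vpaste_paste, id_vpaste]
  rfl

theorem IsOpcartesian.vcomp_cancel {A B : X} {c : LooseChain A B} {p q : Loose B A}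
    {κ : Cell (𝟙 A) (𝟙 B) c p} (hκ : IsOpcartesian κ)
    {φ ψ : Cell (𝟙 A) (𝟙 B) (LooseChain.single p) q} (h : vcomp κ φ = vcomp κ ψ) : φ = ψ := by
  apply (hκ (LooseChain.nil A) (LooseChain.nil B) (𝟙 A) (𝟙 B) q _).unique _ rfl
  -- The chain `c` followed by the empty chain equals `c` only propositionally, so the domain is
  -- generalised before being identified with `c`.
  have key : ∀ (c' : LooseChain A B) (hc : c.append (LooseChain.nil B) = c'),
      vpaste (CellChain.cons κ (CellChain.nil (𝟙 B)) hc) φ (Category.id_comp _)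
        (Category.id_comp _) =
      vpaste (CellChain.cons κ (CellChain.nil (𝟙 B)) hc) ψ (Category.id_comp _)
        (Category.id_comp _) := by
    intro c' hc
    obtain rfl : c' = c := hc.symm.trans c.append_nil
    exact h
  exact key _ rfl

/-! ### Transfer of algebra structure and of gradedness along opcartesian 2-cells -/

namespace RelativeMonad

variable {A E : X} {j : A ⟶ E} {T : RelativeMonad j}

/-- The apex of a cocone for the carrier of an algebra is an algebra, when the cocone is compatible
with the extension operators and its canonical 2-cell is opcartesian. -/
def Algebra.ofCocone {Y Z : X} {p : Loose Y Z} (a : T.Algebra Z) (k : Cocone p a.carrier)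
    (hk : IsOpcartesian (k.canonicalCell j))
    (θ : Cell (𝟙 A) (𝟙 Y) (LooseChain.single (hom j k.pt)) (hom T.carrier k.pt))
    (hθ : vcomp (k.canonicalCell j) θ = paste a.ext k.cell) : T.Algebra Y where
  carrier := k.pt
  ext := θ
  unit_law := by
    -- After the canonical 2-cell, `hθ` trades `θ` for `a.ext`, and the unit law of `a` leaves the
    -- identity pasted with `k.cell`, which is the canonical 2-cell.
    apply hk.vcomp_cancel
    rw [vcomp_idCell]
    have h₁ := vpaste_paste (CellChain.nil (𝟙 A)) (CellChain.single (k.canonicalCell j)) T.unit θ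
    have h₂ : vpaste (CellChain.nil (𝟙 A)) T.unit (Category.id_comp _) (Category.id_comp _) =
      T.unit := id_vpaste _
    rw [h₂] at h₁
    refine h₁.trans ((congrArg (paste T.unit) hθ).trans ?_)
    refine (nil_paste_assoc T.unit a.ext k.cell).symm.trans ?_
    exact congrArg (fun φ : Cell (𝟙 A) (𝟙 Z) (LooseChain.single (hom j a.carrier))
      (hom j a.carrier) => paste φ k.cell) a.unit_law
  ext_law := by
    -- Cancellation is needed here with `E(j, t)` standing before the canonical 2-cell. Two uses of
    -- `hθ` then reduce the law to that of `a`.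
    apply (hk (LooseChain.single (hom j T.carrier)) (LooseChain.nil Y) _ _ _ _).unique _ rfl
    have h₁ := vpaste_paste (CellChain.single (idCell (hom j T.carrier)))
      (CellChain.single (k.canonicalCell j)) T.ext θ
    have h₂ := vpaste_paste (CellChain.single (idCell (hom j T.carrier)))
      (CellChain.single (k.canonicalCell j)) (idCell (hom j T.carrier)) θ
    have h₃ := vpaste_vcomp ((CellChain.single (idCell (hom j T.carrier))).append
      (CellChain.single (k.canonicalCell j))) (paste (idCell (hom j T.carrier)) θ) θ
    rw [vpaste_single_idCell] at h₁ h₂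
    rw [h₂] at h₃
    refine h₃.trans (Eq.trans ?_ h₁.symm)
    refine (congrArg (fun φ => vcomp (paste (idCell (hom j T.carrier)) φ) θ) hθ).trans ?_
    refine Eq.trans ?_ (congrArg (paste T.ext) hθ).symm
    refine (congrArg (fun φ => vcomp φ θ) (single_paste_assoc (idCell (hom j T.carrier)) a.ext
      k.cell).symm).trans ?_
    refine (vcomp_paste_of_vcomp_paste_idCell hθ
      (paste (idCell (hom j T.carrier)) a.ext)).trans ?_
    rw [a.ext_law]
    exact single_paste_assoc T.ext a.ext k.cell

/-- For a cocone of algebras whose canonical 2-cell is opcartesian, a 2-cell out of the apex is a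
graded morphism as soon as its pasting with the cocone is one. -/
theorem isGradedMorphism_of_paste {Y Z D : X} {p : Loose Y Z} {a : T.Algebra Z} {b : T.Algebra Y}
    {a' : T.Algebra D} {φ : Cell (𝟙 Z) (𝟙 Y) (LooseChain.single p) (hom a.carrier b.carrier)}
    (hφ : a.IsGradedMorphism b φ)
    (hop : IsOpcartesian (paste (idCell (hom j a.carrier)) φ)) {q : LooseChain Y D}
    {ψ : Cell (𝟙 Y) (𝟙 D) q (hom b.carrier a'.carrier)}
    (h : a.IsGradedMorphism (p := LooseChain.cons p q) a' (paste φ ψ)) :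
    b.IsGradedMorphism a' ψ := by
  -- Here the cancellation has the chain `q` after the opcartesian 2-cell.
  apply (hop (LooseChain.nil A) q _ _ _ _).unique _ rfl
  have h₁ := vpaste_paste (CellChain.single (paste (idCell (hom j a.carrier)) φ))
    (CellChain.ident q) b.ext ψ
  have h₂ := vpaste_append_idCell_paste (paste (idCell (hom j a.carrier)) φ) ψ
  have h₃ := vpaste_vcomp ((CellChain.single (paste (idCell (hom j a.carrier)) φ)).append
    (CellChain.ident q)) (paste (idCell (hom j b.carrier)) ψ) a'.ext
  rw [h₂] at h₃
  rw [id_vpaste] at h₁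
  refine h₃.trans (Eq.trans ?_ h₁.symm)
  refine (congrArg (fun φ => vcomp φ a'.ext) (single_paste_assoc (idCell (hom j a.carrier)) φ
    ψ)).trans (h.trans ?_)
  refine (single_paste_assoc a.ext φ ψ).symm.trans ?_
  exact congrArg (fun θ => paste θ ψ) hφ.symm

end RelativeMonad

/-- The canonical 2-cell is an opcartesian one followed by an invertible one. This is the only form
in which absoluteness is used. -/
theorem Cocone.IsAbsolute.isOpcartesian {A Y Z W : X} {j : A ⟶ W} {p : Loose Y Z} {f : Z ⟶ W}
    {k : Cocone p f} (hk : k.IsAbsolute j) : IsOpcartesian (k.canonicalCell j) := by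
  obtain ⟨q, κ, φ, hκ, h, hφ⟩ := hk
  rw [← h]
  exact hκ.vpaste_isInvertible hφ

theorem IsOpcartesian.exists_vcomp_eq {A B : X} {c : LooseChain A B} {p q : Loose B A}
    {κ : Cell (𝟙 A) (𝟙 B) c p} (hκ : IsOpcartesian κ) (φ : Cell (𝟙 A) (𝟙 B) c q) :
    ∃ ψ : Cell (𝟙 A) (𝟙 B) (LooseChain.single p) q, vcomp κ ψ = φ := by
  have key : ∀ (c' : LooseChain A B) (hc : c' = c) (hc' : c.append (LooseChain.nil B) = c'),
      ∃ ψ : Cell (𝟙 A) (𝟙 B) (LooseChain.single p) q,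
        vpaste (CellChain.cons κ (CellChain.nil (𝟙 B)) hc') ψ (Category.id_comp _)
          (Category.id_comp _) = hc ▸ φ := by
    intro c' hc hc'
    subst hc'
    exact (hκ (LooseChain.nil A) (LooseChain.nil B) (𝟙 A) (𝟙 B) q _).exists
  exact key c rfl c.append_nil

end Equipment
end FormalCat

/-! ### Strict creation -/

open FormalCat in
theorem mainTheorem5 {X : Type u} [FormalCat.VirtualEquipment.{v, w, z} X] {A E : X} (j : A ⟶ E)
    (T : FormalCat.RelativeMonad j) (AlgT : X) (U : T.Algebra AlgT) (hU : T.IsAlgebraObject U) :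
    FormalCat.StrictlyCreatesAbsoluteColimits j U.carrier := by
  intro Y Z p f k hk habs
  have hop : IsOpcartesian (k.canonicalCell j) := habs.isOpcartesian
  -- The defining equation of `θ` is also the statement that `k.cell` is a graded morphism.
  obtain ⟨θ, hθ⟩ := hop.exists_vcomp_eq (paste (U.restrict f).ext k.cell)
  let b : T.Algebra Y := RelativeMonad.Algebra.ofCocone (U.restrict f) k hop θ hθ
  have hb : (U.restrict f).IsGradedMorphism b k.cell := hθ
  obtain ⟨x, ⟨hx, hxθ⟩, hxu⟩ := hU.existsUnique_tight b
  obtain ⟨l, hl, hlu⟩ := hU.existsUnique_cell (U.restrict f) b f x rfl hx rfl hxθ _ k.cell hb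
  refine ⟨⟨x, l⟩, ⟨⟨hx, hl⟩, ?_⟩, ?_⟩
  · rintro ⟨x', l'⟩ ⟨hx', hl'⟩
    dsimp only at hx' l' hl'
    -- For any lift, `k.cell` is a postcomposite with `u`, hence graded for the induced extension
    -- operator; so that operator solves the equation determining `θ`.
    have hθ' : restrExt U.ext hx' = θ := by
      apply hop.vcomp_cancel
      rw [hθ]
      have := vcomp_paste_whisker_restrExt U.ext rfl hx' l'
      rw [hl'] at this
      exact this
    obtain rfl := hxu x' ⟨hx', hθ'⟩
    rw [hlu l' hl']
  · intro q
    have hid := restrExt_id U.ext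
    have hw : ∀ ψ : CellData.Cell (𝟙 Y) (𝟙 AlgT) q (hom x (𝟙 AlgT)),
        whisker U.carrier (c := LooseChain.cons p q) rfl (Category.id_comp _) (paste l ψ) =
          paste k.cell (whisker U.carrier hx (Category.id_comp _) ψ) := by
      intro ψ
      exact (whisker_paste U.carrier rfl hx (Category.id_comp _) l ψ).trans
        (congrArg (fun φ => paste φ (whisker U.carrier hx (Category.id_comp _) ψ)) hl)
    constructor
    · intro ψ₁ ψ₂ h
      have h' : whisker U.carrier hx (Category.id_comp _) ψ₁ =
          whisker U.carrier hx (Category.id_comp _) ψ₂ := by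
        apply (hk.bijective U.carrier q).1
        refine (hw ψ₁).symm.trans (Eq.trans ?_ (hw ψ₂))
        exact congrArg (whisker U.carrier (c := LooseChain.cons p q) rfl (Category.id_comp _)) h
      -- The common image under `u` is a graded morphism, which makes the uniqueness clause of the
      -- algebra object available.
      have hg := vcomp_paste_whisker_restrExt U.ext hx (Category.id_comp _) ψ₂
      rw [hid, hxθ] at hg
      exact (hU.existsUnique_cell b U x (𝟙 AlgT) hx (Category.id_comp _) hxθ hid q _ hg).unique
        h' rfl
    · intro ε
      -- Factor the image of `ε` downstairs in `E`, show that the factor is graded, and lift it to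
      -- `Alg(T)`.
      obtain ⟨ψ, hψ⟩ := (hk.bijective U.carrier q).2
        (whisker U.carrier (c := LooseChain.cons p q) rfl (Category.id_comp _) ε)
      have hg := vcomp_paste_whisker_restrExt (c := LooseChain.cons p q) U.ext rfl
        (Category.id_comp _) ε
      rw [hid] at hg
      have hgψ : b.IsGradedMorphism U ψ := by
        refine RelativeMonad.isGradedMorphism_of_paste hb hop ?_
        refine Eq.trans ?_ (hg.trans ?_)
        · exact congrArg (fun θ : CellData.Cell (𝟙 Z) (𝟙 AlgT) (LooseChain.cons p q)
            (hom (f ≫ U.carrier) U.carrier) =>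
            vcomp (paste (PastingData.idCell (hom j (f ≫ U.carrier))) θ) U.ext) hψ
        · exact congrArg (fun θ : CellData.Cell (𝟙 Z) (𝟙 AlgT) (LooseChain.cons p q)
            (hom (f ≫ U.carrier) U.carrier) => paste (U.restrict f).ext θ) hψ.symm
      obtain ⟨ψ', hψ', -⟩ := hU.existsUnique_cell b U x (𝟙 AlgT) hx (Category.id_comp _) hxθ hid q
        ψ hgψ
      refine ⟨ψ', ?_⟩
      -- The lifted factor pasted with `l` and the given `ε` have the same graded image under `u`,
      -- hence coincide.
      refine (hU.existsUnique_cell (U.restrict f) U f (𝟙 AlgT) rfl (Category.id_comp _) rfl hid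
        (LooseChain.cons p q) _ hg).unique ((hw ψ').trans ?_) rfl
      rw [hψ']
      exact hψ
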